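/- Let $G=(V,E)$ be a finite simple directed plane graph (antiparallel arcs are allowed) with a source $s$ without incoming arcs, a sink $t\neq s$ without outgoing arcs, arc capacities $c(e)\in[0,\infty]$ and vertex capacities $c(v)\in[0,\infty]$, where $c(s)=c(t)=\infty$. The embedding is given combinatorially, and $t$ lies on the boundary of the infinite face $h_\infty$. Let $G_e$ be the extended graph: every vertex $v$ of finite capacity and degree $d=|in(v)|+|out(v)|$ is replaced by a cycle $C_v$ of $d$ vertices, joined cyclically by undirected edges (pairs of opposite arcs) of capacity $c(v)/2$. Each arc incident to $v$ is attached to a different vertex of $C_v$, in the same clockwise order. The arcs of $G$ keep their capacities, and $G_e$ has no vertex capacities. For a function $f$ on the arcs of $G_e$ let $\hat f$ be its restriction to the arcs of $G$. Flows in $G_e$ are functions $f$ with $0\le f(e)\le c(e)$ that satisfy flow conservation at every vertex other than $s,t$; the value of $f$ is the total flow into $t$. For every arc $e$ let $rev(e)$ be its reverse along the same curve, added with capacity $0$ if it is not an arc. Cancellation procedure, for a flow $g$ and finite capacities $c^*\ge g$: let $c_r(e)=c^*(e)-g(e)+g(rev(e))$ be the residual capacities. Let $\phi(h)$ be the shortest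 path distance from $h_\infty$ to the face $h$ in the dual graph, where the dual arc of $e$ goes from the face $h_\ell(e)$ on the left of $e$ to the face $h_r(e)$ on the right of $e$ and has length $c_r(e)$. Put $r(e)=\max\{0,\phi(h_r(e))-\phi(h_\ell(e))\}$, and output the function $$e\mapsto\max\{0,\ g(e)+r(e)-g(rev(e))-r(rev(e))\}.$$ The symmetric procedure is the same procedure in the mirror image of the embedding (left and right are exchanged). Let $f$ be any flow in $G_e$. Let $f'$ be the output of the procedure on $G_e$ for $f$ and the capacities $c'$ with $c'(e)=f(e)$ for $e\in E$ and $c'(e)=c(v)/2$ for the arcs of $C_v$. Let $f''$ be the output of the symmetric procedure on $G_e$ for $f'$ and the capacities $c''$ with $c''(e)=f'(e)$ for $e\in E$ and $c''(e)=c(v)/2$ for the arcs of $C_v$. Then: 1. $f''$ is a flow in $G_e$ (for the original capacities); 2. $f''$ has the same value as $f$; 3. $\hat{f''}(e)\le\hat{f'}(e)\le\hat f(e)$ for every $e\in E$; 4. $\hat{f''}$ is acyclic: $G$ has no directed cycle on all of whose arcs $\hat{f''}$ is positive. -/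

import Mathlib

open scoped ENNReal

/-- A combinatorial embedding of a graph (loops and parallel edges allowed).
Every edge curve is represented by two opposite darts, exchanged by `rev`; `rot` sends a dart to
the next one in clockwise order around its tail; `left d` is the face on the left of `d`.
The face on the left is kept when one goes along `d` and then turns to the clockwise successor of
`rev d`. Several facial walks may bound the same face (this happens if the graph is disconnected).
-/
structure EmbeddedGraph (V D F : Type*) where
  tail : D → V
  rev : D → D
  rev_rev : ∀ d, rev (rev d) = d
  rev_ne : ∀ d, rev d ≠ d
  rot : Equiv.Perm D
  tail_rot : ∀ d, tail (rot d) = tail d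
  rot_sameCycle : ∀ d d', tail d = tail d' → rot.SameCycle d d'
  left : D → F
  left_rot_rev : ∀ d, left (rot (rev d)) = left d

namespace EmbeddedGraph

variable {V D F : Type*} (M : EmbeddedGraph V D F)

/-- The end vertex of a dart. -/
def head (d : D) : V := M.tail (M.rev d)

/-- The face on the right of a dart. -/
def right (d : D) : F := M.left (M.rev d)

/-- The connected components of the graph. -/
def Component : Type _ := Quot (fun u v : V => ∃ d, M.tail d = u ∧ M.head d = v)

/-- The embedding is an embedding in the sphere: the dual graph is connected, and Euler's formula
`|V| - |E| + |F| = 1 + (number of components)` holds. -/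
structure IsPlane : Prop where
  dual_connected : ∀ a b : F, Relation.EqvGen (fun a b => ∃ d, M.left d = a ∧ M.right d = b) a b
  euler : Nat.card V + Nat.card F = Nat.card D / 2 + 1 + Nat.card M.Component

theorem tail_rot_symm (d : D) : M.tail (M.rot.symm d) = M.tail d := by
  have h := M.tail_rot (M.rot.symm d)
  rwa [Equiv.apply_symm_apply, eq_comm] at h

/-- The mirror image of an embedding: clockwise and counterclockwise, left and right are
exchanged. -/
def mirror : EmbeddedGraph V D F where
  tail := M.tail
  rev := M.rev
  rev_rev := M.rev_rev
  rev_ne := M.rev_ne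
  rot := M.rot.symm
  tail_rot := M.tail_rot_symm
  rot_sameCycle d d' h := (M.rot_sameCycle d d' h).inv
  left := M.right
  left_rot_rev d := by
    have h := M.left_rot_rev (M.rev (M.rot.symm (M.rev d)))
    rw [M.rev_rev, Equiv.apply_symm_apply] at h
    exact h.symm

section Flow

open scoped Classical in
/-- The amount of `f` that enters `v`. -/
noncomputable def inflow [Fintype D] (f : D → ℝ) (v : V) : ℝ :=
  ∑ d with M.head d = v, f d

open scoped Classical in
/-- The amount of `f` that leaves `v`. -/
noncomputable def outflow [Fintype D] (f : D → ℝ) (v : V) : ℝ :=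
  ∑ d with M.tail d = v, f d

/-- `f` is a flow function from `s` to `t` for the arc capacities `c` (no vertex capacities).
A dart that is not an arc has capacity `0`. -/
structure IsFlow [Fintype D] (c : D → ℝ≥0∞) (s t : V) (f : D → ℝ) : Prop where
  nonneg : ∀ d, 0 ≤ f d
  le_cap : ∀ d, ENNReal.ofReal (f d) ≤ c d
  conserve : ∀ v, v ≠ s → v ≠ t → M.inflow f v = M.outflow f v

/-- The value of a flow: the amount that enters the sink `t`. -/
noncomputable def value [Fintype D] (t : V) (f : D → ℝ) : ℝ := M.inflow f t

/-- `p` is a directed path (walk) in the dual graph from the face `a` to the face `b`: the arc dual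
to `d` goes from the face on the left of `d` to the face on the right of `d`. -/
def IsDualPath : F → List D → F → Prop
  | a, [], b => a = b
  | a, d :: p, b => M.left d = a ∧ IsDualPath (M.right d) p b

/-- The shortest path distance from `a` to `b` in the dual graph, where the arc dual to `d` has
length `len d`. -/
noncomputable def dualDist (len : D → ℝ) (a b : F) : ℝ :=
  sInf {x | ∃ p, M.IsDualPath a p b ∧ x = (p.map len).sum}

/-- The circulation without clockwise residual cycles for the capacities `c`, with the face
`outer` as the infinite face: the positive part of the difference of the potentials (distances
from `outer` in the dual graph) on the right and on the left of a dart. -/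
noncomputable def circulation (outer : F) (c : D → ℝ) (d : D) : ℝ :=
  max 0 (M.dualDist c outer (M.right d) - M.dualDist c outer (M.left d))

/-- The residual capacity of a dart with respect to `f` and the capacities `c`. -/
def residual (c f : D → ℝ) (d : D) : ℝ := c d - f d + f (M.rev d)

/-- The procedure that changes `f` into a flow without clockwise residual cycles (for the
capacities `c`): compute the circulation above in the residual graph, add it to `f`, and let the
flows on `d` and `rev d` cancel each other. -/
noncomputable def cancelClockwise (outer : F) (c f : D → ℝ) (d : D) : ℝ :=
  let r := M.circulation outer (M.residual c f)
  max 0 (f d + r d - (f (M.rev d) + r (M.rev d)))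

end Flow

end EmbeddedGraph

/-- A simple directed graph with a plane embedding, a source, a sink, arc capacities and vertex
capacities. Each edge curve carries an arc in at least one of its two directions. Two opposite arcs
may be drawn as two curves, or along one curve; the latter only between vertices of infinite
capacity (at a vertex of finite capacity the arcs have distinct places in the clockwise order). -/
structure PlanarNetwork (V D F : Type*) extends EmbeddedGraph V D F where
  isPlane : toEmbeddedGraph.IsPlane
  arcs : Set D
  arc_or_arc : ∀ d, d ∈ arcs ∨ rev d ∈ arcs
  loopless : ∀ d ∈ arcs, tail d ≠ toEmbeddedGraph.head d
  simple : ∀ d ∈ arcs, ∀ d' ∈ arcs, tail d = tail d' →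
    toEmbeddedGraph.head d = toEmbeddedGraph.head d' → d = d'
  s : V
  t : V
  s_ne_t : s ≠ t
  s_no_in : ∀ d ∈ arcs, toEmbeddedGraph.head d ≠ s
  t_no_out : ∀ d ∈ arcs, tail d ≠ t
  arcCap : D → ℝ≥0∞
  vertexCap : V → ℝ≥0∞
  vertexCap_s : vertexCap s = ∞
  vertexCap_t : vertexCap t = ∞
  shared_curve : ∀ d ∈ arcs, rev d ∈ arcs → vertexCap (tail d) = ∞
  /-- the infinite face -/
  outer : F
  /-- `t` is incident to the infinite face (a condition only if some arc is incident to `t`) -/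
  t_outer : (∃ d, tail d = t) → ∃ d, tail d = t ∧ left d = outer

namespace PlanarNetwork

variable {V D F : Type*} (G : PlanarNetwork V D F)

/-- A function on the arcs of `G` is acyclic if there is no flow-cycle, that is, no cycle
`e₀, …, e_{k-1}` (`k ≥ 1`) of arcs on all of which the function is positive. -/
def Acyclic (g : G.arcs → ℝ) : Prop :=
  ¬ ∃ (k : ℕ) (e : ZMod (k + 1) → G.arcs),
    (∀ i, G.head (e i : D) = G.tail (e (i + 1) : D)) ∧ ∀ i, 0 < g (e i)

/-- The places of the arcs at the vertices of finite capacity: the vertices that replace such a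
vertex `v` in the extended graph are the darts with tail `v`. -/
abbrev Slot : Type _ := {x : D // G.vertexCap (G.tail x) ≠ ∞}

/-- The vertices of the extended graph: the vertices of infinite capacity, and the slots. -/
inductive ExtVertex
  | old (v : V) (h : G.vertexCap v = ∞)
  | slot (x : G.Slot)

/-- The darts of the extended graph: those of `G`; and for every slot `x` the two darts of the
edge between `x` and the clockwise next slot, `ring x true` going clockwise, `ring x false` back. -/
inductive ExtDart
  | old (d : D)
  | ring (x : G.Slot) (clockwise : Bool)

/-- The faces of the extended graph: those of `G`; and for every (not isolated) vertex `v` of finite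
capacity the inside of the cycle that replaces it. -/
inductive ExtFace
  | old (h : F)
  | inside (v : V) (hv : G.vertexCap v ≠ ∞ ∧ ∃ d, G.tail d = v)

instance [Finite D] : Finite G.ExtDart :=
  Finite.of_injective
    (fun d : G.ExtDart => match d with
      | .old d => (Sum.inl d : D ⊕ (G.Slot × Bool))
      | .ring x b => Sum.inr (x, b))
    (by rintro (d | ⟨x, b⟩) (d' | ⟨x', b'⟩) h <;> simp_all)

noncomputable instance [Finite D] : Fintype G.ExtDart := Fintype.ofFinite _

variable {G} in
/-- The clockwise next slot at the same vertex. -/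
def Slot.next (x : G.Slot) : G.Slot := ⟨G.rot x.1, by rw [G.tail_rot]; exact x.2⟩

variable {G} in
/-- The clockwise previous slot at the same vertex. -/
def Slot.prev (x : G.Slot) : G.Slot := ⟨G.rot.symm x.1, by rw [G.tail_rot_symm]; exact x.2⟩

theorem Slot.prev_next (x : G.Slot) : Slot.prev (Slot.next x) = x :=
  Subtype.ext (by simp [Slot.next, Slot.prev])

theorem Slot.next_prev (x : G.Slot) : Slot.next (Slot.prev x) = x :=
  Subtype.ext (by simp [Slot.next, Slot.prev])

open scoped Classical in
/-- The tail of a dart of the extended graph. -/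
noncomputable def extTail : G.ExtDart → G.ExtVertex
  | .old d => if h : G.vertexCap (G.tail d) = ∞ then .old (G.tail d) h else .slot ⟨d, h⟩
  | .ring x true => .slot x
  | .ring x false => .slot (Slot.next x)

/-- The opposite dart in the extended graph. -/
def extRev : G.ExtDart → G.ExtDart
  | .old d => .old (G.rev d)
  | .ring x b => .ring x (!b)

open scoped Classical in
/-- The clockwise next dart in the extended graph. At a slot `x` the clockwise order is: `x` itself
(pointing outwards), the dart to the next slot, the dart to the previous slot. -/
noncomputable def extRotFun : G.ExtDart → G.ExtDart
  | .old d => if h : G.vertexCap (G.tail d) = ∞ then .old (G.rot d) else .ring ⟨d, h⟩ true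
  | .ring x true => .ring (Slot.prev x) false
  | .ring x false => .old (Slot.next x).1

open scoped Classical in
/-- The counterclockwise next dart in the extended graph. -/
noncomputable def extRotInv : G.ExtDart → G.ExtDart
  | .old d => if h : G.vertexCap (G.tail d) = ∞ then .old (G.rot.symm d)
      else .ring (Slot.prev (G := G) ⟨d, h⟩) false
  | .ring x true => .old x.1
  | .ring x false => .ring (Slot.next x) true

theorem extRot_left_inv (d : G.ExtDart) : G.extRotInv (G.extRotFun d) = d := by
  rcases d with d | ⟨x, _ | _⟩
  · by_cases h : G.vertexCap (G.tail d) = ∞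
    · simp [extRotFun, extRotInv, h, G.tail_rot]
    · simp [extRotFun, extRotInv, h]
  · have h : G.vertexCap (G.tail (Slot.next x).1) ≠ ∞ := (Slot.next x).2
    simp [extRotFun, extRotInv, h, Slot.prev_next]
  · simp [extRotFun, extRotInv, Slot.next_prev]

theorem extRot_right_inv (d : G.ExtDart) : G.extRotFun (G.extRotInv d) = d := by
  rcases d with d | ⟨x, _ | _⟩
  · by_cases h : G.vertexCap (G.tail d) = ∞
    · simp [extRotFun, extRotInv, h, G.tail_rot_symm]
    · simp [extRotFun, extRotInv, h, Slot.next_prev]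
  · simp [extRotFun, extRotInv, Slot.prev_next]
  · have h : G.vertexCap (G.tail x.1) ≠ ∞ := x.2
    simp [extRotFun, extRotInv, h]

/-- The rotation of the extended graph. -/
noncomputable def extRot : Equiv.Perm G.ExtDart :=
  ⟨G.extRotFun, G.extRotInv, G.extRot_left_inv, G.extRot_right_inv⟩

theorem extRot_apply (d : G.ExtDart) : G.extRot d = G.extRotFun d := rfl

theorem extTail_rot (d : G.ExtDart) : G.extTail (G.extRot d) = G.extTail d := by
  rw [extRot_apply]
  rcases d with d | ⟨x, _ | _⟩
  · by_cases h : G.vertexCap (G.tail d) = ∞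
    · simp [extRotFun, extTail, h, G.tail_rot]
    · simp [extRotFun, extTail, h]
  · have h : G.vertexCap (G.tail (Slot.next x).1) ≠ ∞ := (Slot.next x).2
    simp [extRotFun, extTail, h]
  · simp [extRotFun, extTail, Slot.next_prev]

theorem extRot_sameCycle_slot (x : G.Slot) (d : G.ExtDart) (h : G.extTail d = .slot x) :
    G.extRot.SameCycle (.old x.1) d := by
  have hx : G.vertexCap (G.tail x.1) ≠ ∞ := x.2
  have h1 : G.extRot (.old x.1) = .ring x true := by simp [extRot_apply, extRotFun, hx]
  have h2 : G.extRot (.ring x true) = .ring (Slot.prev x) false := rfl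
  rcases d with d | ⟨y, _ | _⟩
  · by_cases hd : G.vertexCap (G.tail d) = ∞
    · simp [extTail, hd] at h
    · simp only [extTail, hd, dite_false, ExtVertex.slot.injEq] at h
      subst h; exact Equiv.Perm.SameCycle.refl _ _
  · simp only [extTail, ExtVertex.slot.injEq] at h
    subst h
    refine ⟨2, ?_⟩
    change G.extRot (G.extRot _) = _
    rw [h1, h2, Slot.prev_next]
  · simp only [extTail, ExtVertex.slot.injEq] at h
    subst h
    exact ⟨1, by rw [zpow_one, h1]⟩

theorem extRot_pow_old (d : D) (h : G.vertexCap (G.tail d) = ∞) (k : ℕ) :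
    (G.extRot ^ k) (.old d) = .old ((G.rot ^ k) d) ∧
      G.vertexCap (G.tail ((G.rot ^ k) d)) = ∞ := by
  induction k with
  | zero => exact ⟨rfl, h⟩
  | succ k ih =>
    rw [pow_succ', pow_succ', Equiv.Perm.mul_apply, Equiv.Perm.mul_apply, ih.1, G.tail_rot]
    refine ⟨?_, ih.2⟩
    simp [extRot_apply, extRotFun, ih.2]

theorem extRot_sameCycle [Finite D] (d d' : G.ExtDart) (h : G.extTail d = G.extTail d') :
    G.extRot.SameCycle d d' := by
  rcases hv : G.extTail d with ⟨v, hvc⟩ | x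
  · have key : ∀ e : G.ExtDart, G.extTail e = .old v hvc →
        ∃ a : D, e = .old a ∧ G.tail a = v := by
      rintro (e | ⟨y, _ | _⟩) he
      · by_cases hd : G.vertexCap (G.tail e) = ∞
        · simp only [extTail, hd, dite_true, ExtVertex.old.injEq] at he
          exact ⟨e, rfl, he⟩
        · simp [extTail, hd] at he
      · simp [extTail] at he
      · simp [extTail] at he
    obtain ⟨a, rfl, ha⟩ := key d hv
    obtain ⟨b, rfl, hb⟩ := key d' (h ▸ hv)
    obtain ⟨k, hk⟩ := (G.rot_sameCycle a b (ha.trans hb.symm)).exists_nat_pow_eq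
    refine ⟨k, ?_⟩
    rw [zpow_natCast, (G.extRot_pow_old a (ha ▸ hvc) k).1, hk]
  · exact (G.extRot_sameCycle_slot x d hv).symm.trans (G.extRot_sameCycle_slot x d' (h ▸ hv))

/-- The face on the left of a dart of the extended graph. A cycle that replaces a vertex, traversed
clockwise, has its inside on the right. -/
def extLeft : G.ExtDart → G.ExtFace
  | .old d => .old (G.left d)
  | .ring x true => .old (G.right x.1)
  | .ring x false => .inside (G.tail x.1) ⟨x.2, x.1, rfl⟩

theorem extLeft_rot_rev (d : G.ExtDart) : G.extLeft (G.extRot (G.extRev d)) = G.extLeft d := by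
  rw [extRot_apply]
  rcases d with d | ⟨x, _ | _⟩
  · by_cases h : G.vertexCap (G.tail (G.rev d)) = ∞
    · simp [extRotFun, extRev, extLeft, h, G.left_rot_rev]
    · simp [extRotFun, extRev, extLeft, h, EmbeddedGraph.right, G.rev_rev]
  · simp [extRev, extRotFun, extLeft, Slot.prev, G.tail_rot_symm]
  · have h := G.left_rot_rev (G.rev x.1)
    rw [G.rev_rev] at h
    simp [extRev, extRotFun, extLeft, Slot.next, EmbeddedGraph.right, h]

/-- The extended graph `G_e` with its embedding: every vertex `v` of finite capacity is replaced by
a cycle `C_v` with one vertex for each arc incident to `v`, in the same clockwise order. -/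
noncomputable def ext [Finite D] : EmbeddedGraph G.ExtVertex G.ExtDart G.ExtFace where
  tail := G.extTail
  rev := G.extRev
  rev_rev d := by rcases d with d | ⟨x, b⟩ <;> simp [extRev, G.rev_rev]
  rev_ne d := by rcases d with d | ⟨x, b⟩ <;> simp [extRev, G.rev_ne]
  rot := G.extRot
  tail_rot := G.extTail_rot
  rot_sameCycle := G.extRot_sameCycle
  left := G.extLeft
  left_rot_rev := G.extLeft_rot_rev

/-- The source in the extended graph. -/
def extS : G.ExtVertex := .old G.s G.vertexCap_s

/-- The sink in the extended graph. -/
def extT : G.ExtVertex := .old G.t G.vertexCap_t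

/-- The infinite face of the extended graph. -/
def extOuter : G.ExtFace := .old G.outer

open scoped Classical in
/-- The capacities in the extended graph: arcs of `G` keep their capacity, and the (undirected)
edges of `C_v` have capacity `c(v) / 2`. Darts of `G` that are not arcs get capacity `0`. -/
noncomputable def extCap : G.ExtDart → ℝ≥0∞
  | .old d => if d ∈ G.arcs then G.arcCap d else 0
  | .ring x _ => G.vertexCap (G.tail x.1) / 2

/-- `f` is a flow function in the extended graph. -/
def IsExtFlow [Finite D] (f : G.ExtDart → ℝ) : Prop := G.ext.IsFlow G.extCap G.extS G.extT f

/-- The value of a flow in the extended graph. -/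
noncomputable def extValue [Finite D] (f : G.ExtDart → ℝ) : ℝ := G.ext.value G.extT f

/-- The restriction of a function on the arcs of the extended graph to the arcs of `G`. -/
def restrict (f : G.ExtDart → ℝ) (e : G.arcs) : ℝ := f (.old e.1)

/-- The capacities that keep the flow on the arcs of `G` from increasing beyond `f`: the capacity of
a dart of `G` is its flow (which is `0` if the dart is not an arc), the edges of `C_v` keep the
capacity `c(v) / 2` (which is finite). -/
noncomputable def restrictedCap (f : G.ExtDart → ℝ) : G.ExtDart → ℝ
  | .old d => f (.old d)
  | .ring x _ => (G.vertexCap (G.tail x.1)).toReal / 2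

/-- The first pass `f ↦ f'`: the procedure for clockwise residual cycles in the extended graph, with
the capacities restricted by `f`. -/
noncomputable def firstPass [Finite D] (f : G.ExtDart → ℝ) : G.ExtDart → ℝ :=
  G.ext.cancelClockwise G.extOuter (G.restrictedCap f) f

/-- The second pass `f' ↦ f''`: the symmetric procedure for counterclockwise residual cycles, with
the capacities restricted by `f'`. -/
noncomputable def secondPass [Finite D] (f : G.ExtDart → ℝ) : G.ExtDart → ℝ :=
  G.ext.mirror.cancelClockwise G.extOuter (G.restrictedCap f) f

end PlanarNetwork

/-!
Each pass keeps the net flow at every vertex, since it adds the tension of a face potential, which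
sums to zero around a vertex. The restricted capacities keep the flow on the arcs of `G` from
increasing. So the flow property, the value and the monotonicity are direct, and the point is
acyclicity.

On a plane graph Euler's formula makes every directed cycle the tension of a face potential `ψ`
(`IsPlane.exists_face_potential`). It is enough to show that `ψ` is nowhere larger than on the infinite
face if the cycle carries flow after the first pass (`IsRingFlow.potential_le_outer`). The second pass
is the mirror image and gives the other inequality, so that `ψ` would be constant.

What the first pass provides is that the infinite face reaches every face across saturated darts
(`reflTransGen_saturated`), because the distances are the largest feasible potential. Seen in `G`, a
path of saturated darts consists of *free steps*, from left to right across a dart whose reverse has no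
flow, and *ring steps*, which cross the ring of a vertex inwards and outwards at two saturated edges.
If `ψ` is larger somewhere, no free step enters the set of its maxima. This set contains a smaller set
`A` that no free step enters either and in which free steps lead from every face to every other one.
So a path from the infinite face first enters `A` by a ring step, at a vertex `v` say. Since the ring
is saturated there, conservation on the ring gives a dart `e` at `v` that carries flow away from `v` and
has `A` on both sides (`IsRingFlow.exists_dart_of_ringStep`).

Free steps within `A` lead from the right of `e` back to its left, and crossing `e` closes this walk. It
crosses flow only from left to right, hence it has a vertex potential `p` that never increases along
the flow and decreases along `e`. The path from the infinite face to `v` avoids `A`, so that `p` has the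
same value at `v` and at `t` (`IsPlane.exists_potential_of_supported`). Then the flow on `e` never
reaches `t`, which contradicts conservation (`IsRingFlow.potential_tail_le_head`).
-/

namespace EmbeddedGraph

variable {V D F : Type*} (M : EmbeddedGraph V D F)

/-! ### Rotation, reversal and mirror image -/

theorem left_rot (d : D) : M.left (M.rot d) = M.right d := by
  have h := M.left_rot_rev (M.rev d)
  rwa [M.rev_rev] at h

theorem right_rot_symm (d : D) : M.right (M.rot.symm d) = M.left d := by
  rw [← M.left_rot, Equiv.apply_symm_apply]

theorem left_rev (d : D) : M.left (M.rev d) = M.right d := rfl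

theorem right_rev (d : D) : M.right (M.rev d) = M.left d := by rw [right, M.rev_rev]

theorem tail_rev (d : D) : M.tail (M.rev d) = M.head d := rfl

theorem head_rev (d : D) : M.head (M.rev d) = M.tail d := by rw [head, M.rev_rev]

theorem mirror_right (d : D) : M.mirror.right d = M.left d := M.right_rev d

variable {M} in
theorem IsPlane.mirror (h : M.IsPlane) : M.mirror.IsPlane where
  dual_connected a b := by
    refine (h.dual_connected a b).mono ?_
    rintro a b ⟨d, rfl, rfl⟩
    exact ⟨M.rev d, M.right_rev d, M.mirror_right (M.rev d)⟩
  euler := h.euler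

theorem sum_comp_rev [Fintype D] (p : D → ℝ) : ∑ d, p (M.rev d) = ∑ d, p d :=
  Equiv.sum_comp (Function.Involutive.toPerm M.rev M.rev_rev) p

theorem inflow_eq_outflow_rev [Fintype D] (f : D → ℝ) (v : V) :
    M.inflow f v = M.outflow (fun d => f (M.rev d)) v := by
  classical
  simp only [inflow, outflow, Finset.sum_filter]
  rw [← M.sum_comp_rev]
  simp only [head_rev]

theorem outflow_comp_rot [Fintype D] (f : D → ℝ) (v : V) :
    M.outflow (fun d => f (M.rot d)) v = M.outflow f v := by
  classical
  simp only [outflow, Finset.sum_filter]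
  rw [← Equiv.sum_comp M.rot fun d => if M.tail d = v then f d else 0]
  simp only [M.tail_rot]

theorem outflow_sub [Fintype D] (f g : D → ℝ) (v : V) :
    M.outflow (fun d => f d - g d) v = M.outflow f v - M.outflow g v := by
  classical
  simp only [outflow, Finset.sum_sub_distrib]

theorem sum_mul_outflow [Fintype V] [Fintype D] (p : V → ℝ) (f : D → ℝ) :
    ∑ v, p v * M.outflow f v = ∑ d, p (M.tail d) * f d := by
  classical
  rw [← Finset.sum_fiberwise (s := Finset.univ) (g := M.tail)]
  refine Finset.sum_congr rfl fun v _ => ?_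
  rw [outflow, Finset.mul_sum]
  refine Finset.sum_congr (by ext; simp) fun d hd => ?_
  rw [(Finset.mem_filter.1 hd).2]

/-! ### Vertex and face potentials -/

/-- The tension of a potential `p` along a labelling `τ` of the darts by their start: the
difference between the potentials at the two ends. With `τ = tail` this is the coboundary of a
vertex potential, with `τ = left` that of a face potential. -/
def tension {X : Type*} (τ : D → X) : (X → ℝ) →ₗ[ℝ] (D → ℝ) where
  toFun p d := p (τ d) - p (τ (M.rev d))
  map_add' p q := by ext d; simp only [Pi.add_apply]; ring
  map_smul' a p := by
    ext d; simp only [Pi.smul_apply, smul_eq_mul, RingHom.id_apply]; ring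

theorem tension_apply {X : Type*} (τ : D → X) (p : X → ℝ) (d : D) :
    M.tension τ p d = p (τ d) - p (τ (M.rev d)) := rfl

/-- The functions on the darts that change sign under reversal. -/
def antisymm : Submodule ℝ (D → ℝ) where
  carrier := {k | ∀ d, k (M.rev d) = -k d}
  add_mem' {a b} ha hb d := by
    simp only [Pi.add_apply, ha d, hb d]; ring
  zero_mem' d := by simp
  smul_mem' a k hk d := by
    simp only [Pi.smul_apply, smul_eq_mul, hk d]; ring

theorem mem_antisymm {k : D → ℝ} : k ∈ M.antisymm ↔ ∀ d, k (M.rev d) = -k d := Iff.rfl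

theorem tension_mem_antisymm {X : Type*} (τ : D → X) (p : X → ℝ) :
    M.tension τ p ∈ M.antisymm := by
  intro d
  simp only [tension_apply, M.rev_rev]; ring

theorem sum_tension_mul [Fintype D] {X : Type*} (τ : D → X) (p : X → ℝ) {k : D → ℝ}
    (hk : k ∈ M.antisymm) :
    ∑ d, M.tension τ p d * k d = 2 * ∑ d, p (τ d) * k d := by
  have h : ∑ d, p (τ (M.rev d)) * k d = -∑ d, p (τ d) * k d := by
    rw [← M.sum_comp_rev fun d => p (τ d) * k d, ← Finset.sum_neg_distrib]
    refine Finset.sum_congr rfl fun d _ => ?_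
    rw [M.mem_antisymm.1 hk]; ring
  simp only [tension_apply, sub_mul, Finset.sum_sub_distrib, h]
  ring

/-- Around every vertex the tension of a face potential telescopes, so that it is a circulation. -/
theorem sum_tail_mul_tension_left [Fintype D] (p : V → ℝ) (q : F → ℝ) :
    ∑ d, p (M.tail d) * M.tension M.left q d = 0 := by
  have h : ∑ d, p (M.tail d) * q (M.left (M.rev d)) = ∑ d, p (M.tail d) * q (M.left d) := by
    rw [← Equiv.sum_comp M.rot fun d => p (M.tail d) * q (M.left d)]
    simp only [M.tail_rot, M.left_rot, M.left_rev]
  simp only [tension_apply, mul_sub, Finset.sum_sub_distrib, h, sub_self]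

theorem sum_tension_tail_mul_tension_left [Fintype D] (p : V → ℝ) (q : F → ℝ) :
    ∑ d, M.tension M.tail p d * M.tension M.left q d = 0 := by
  rw [M.sum_tension_mul _ _ (M.tension_mem_antisymm _ _), M.sum_tail_mul_tension_left, mul_zero]

theorem two_mul_finrank_antisymm [Fintype D] :
    2 * Module.finrank ℝ M.antisymm = Fintype.card D := by
  classical
  -- an orientation of the edge curves
  obtain ⟨o, ho⟩ : ∃ o : D → ℝ, ∀ d, o (M.rev d) = -o d ∧ o d * o d = 1 := by
    let e := Fintype.equivFin D
    refine ⟨fun d => if e d < e (M.rev d) then 1 else -1, fun d => ?_⟩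
    have hne : e (M.rev d) ≠ e d := fun h => M.rev_ne d (e.injective h)
    rcases lt_or_gt_of_ne hne with h | h
    · simp [M.rev_rev, h, h.not_gt]
    · simp [M.rev_rev, h, h.not_gt]
  let S : Submodule ℝ (D → ℝ) :=
    { carrier := {k | ∀ d, k (M.rev d) = k d}
      add_mem' := fun {a b} ha hb d => by simp only [Pi.add_apply, ha d, hb d]
      zero_mem' := fun d => by simp
      smul_mem' := fun a k hk d => by simp only [Pi.smul_apply, hk d] }
  -- multiplication by the orientation exchanges even and odd functions
  let Φ : M.antisymm ≃ₗ[ℝ] S :=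
    { toFun := fun k => ⟨fun d => o d * k.1 d, fun d => by
        simp only [(ho d).1, M.mem_antisymm.1 k.2 d]; ring⟩
      invFun := fun k => ⟨fun d => o d * k.1 d, fun d => by
        simp only [(ho d).1, k.2 d]; ring⟩
      map_add' := fun a b => by
        ext d; simp only [Submodule.coe_add, Pi.add_apply]; ring
      map_smul' := fun a b => by
        ext d; simp only [Submodule.coe_smul, Pi.smul_apply, smul_eq_mul, RingHom.id_apply]; ring
      left_inv := fun k => by
        ext d; simp only [← mul_assoc, (ho d).2, one_mul]
      right_inv := fun k => by
        ext d; simp only [← mul_assoc, (ho d).2, one_mul] }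
  have hcompl : IsCompl M.antisymm S := by
    constructor
    · rw [Submodule.disjoint_def]
      intro k h1 h2
      ext d
      have := M.mem_antisymm.1 h1 d
      rw [h2 d] at this
      simp only [Pi.zero_apply]; linarith
    · rw [codisjoint_iff, eq_top_iff]
      intro k _
      refine Submodule.mem_sup.2 ⟨fun d => (k d - k (M.rev d)) / 2, fun d => ?_,
        fun d => (k d + k (M.rev d)) / 2, fun d => ?_, ?_⟩
      · simp only [M.rev_rev]; ring
      · simp only [M.rev_rev]; ring
      · ext d; simp only [Pi.add_apply]; ring
  have h := Submodule.finrank_add_eq_of_isCompl hcompl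
  rw [← Φ.finrank_eq, Module.finrank_fintype_fun_eq_card] at h
  omega

theorem card_le_finrank_range_tension_tail [Fintype V] :
    Fintype.card V ≤ Module.finrank ℝ (LinearMap.range (M.tension M.tail)) +
      Nat.card M.Component := by
  have : Finite M.Component := by unfold Component; infer_instance
  have := Fintype.ofFinite M.Component
  let Φ : LinearMap.ker (M.tension M.tail) →ₗ[ℝ] (M.Component → ℝ) :=
    { toFun := fun p => Quot.lift p.1 (by
        rintro _ _ ⟨d, rfl, rfl⟩
        have h := congrFun (LinearMap.mem_ker.1 p.2) d
        rw [tension_apply, Pi.zero_apply] at h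
        exact sub_eq_zero.1 h)
      map_add' := fun p q => by ext ⟨v⟩; rfl
      map_smul' := fun a p => by ext ⟨v⟩; rfl }
  have hΦ : Function.Injective Φ := by
    intro p q h
    ext v
    exact congrFun h (Quot.mk _ v)
  have h1 := LinearMap.finrank_le_finrank_of_injective hΦ
  have h2 := (M.tension M.tail).finrank_range_add_finrank_ker
  rw [Module.finrank_fintype_fun_eq_card] at h1 h2
  rw [Nat.card_eq_fintype_card]
  omega

variable {M} in
theorem IsPlane.card_le_finrank_range_tension_left [Fintype F] (h : M.IsPlane) :
    Fintype.card F ≤ Module.finrank ℝ (LinearMap.range (M.tension M.left)) + 1 := by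
  rcases isEmpty_or_nonempty F with hF | ⟨⟨a⟩⟩
  · simp
  have hΦ : Function.Injective
      ((LinearMap.proj a).comp (LinearMap.ker (M.tension M.left)).subtype : _ →ₗ[ℝ] ℝ) := by
    rw [← LinearMap.ker_eq_bot, LinearMap.ker_eq_bot']
    intro p hp
    ext b
    have key : ∀ x y, Relation.EqvGen (fun a b => ∃ d, M.left d = a ∧ M.right d = b) x y →
        p.1 x = p.1 y := by
      intro x y hxy
      induction hxy with
      | rel x y hxy =>
        obtain ⟨d, rfl, rfl⟩ := hxy
        have h := congrFun (LinearMap.mem_ker.1 p.2) d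
        rw [tension_apply, Pi.zero_apply] at h
        exact sub_eq_zero.1 h
      | refl => rfl
      | symm _ _ _ ih => exact ih.symm
      | trans _ _ _ _ _ ih1 ih2 => exact ih1.trans ih2
    exact (key b a (h.dual_connected b a)).trans hp
  have h1 := LinearMap.finrank_le_finrank_of_injective hΦ
  have h2 := (M.tension M.left).finrank_range_add_finrank_ker
  rw [Module.finrank_fintype_fun_eq_card] at h2
  rw [Module.finrank_self] at h1
  omega

variable {M} in
/-- Euler's formula in the form that the proof uses: on a plane graph every antisymmetric function
on the darts is the sum of a vertex tension and a face tension. The two kinds of tensions are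
orthogonal, and by Euler's formula their dimensions add up to the number of edges. -/
theorem IsPlane.exists_potentials [Finite V] [Finite D] [Finite F] (h : M.IsPlane) {k : D → ℝ}
    (hk : k ∈ M.antisymm) :
    ∃ (p : V → ℝ) (q : F → ℝ), k = M.tension M.tail p + M.tension M.left q := by
  cases nonempty_fintype V
  cases nonempty_fintype D
  cases nonempty_fintype F
  set S := LinearMap.range (M.tension M.tail)
  set T := LinearMap.range (M.tension M.left)
  have hdisj : S ⊓ T = ⊥ := by
    rw [← disjoint_iff, Submodule.disjoint_def]
    rintro _ ⟨p, rfl⟩ ⟨q, hq⟩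
    have h0 := M.sum_tension_tail_mul_tension_left p q
    rw [hq, Finset.sum_eq_zero_iff_of_nonneg fun d _ => mul_self_nonneg _] at h0
    ext d
    exact mul_self_eq_zero.1 (h0 d (Finset.mem_univ d))
  have hle : S ⊔ T ≤ M.antisymm := by
    rw [sup_le_iff]
    constructor
    · rintro _ ⟨p, rfl⟩; exact M.tension_mem_antisymm _ p
    · rintro _ ⟨p, rfl⟩; exact M.tension_mem_antisymm _ p
  have hST : S ⊔ T = M.antisymm := by
    refine Submodule.eq_of_le_of_finrank_le hle ?_
    have h1 := Submodule.finrank_sup_add_finrank_inf_eq S T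
    rw [hdisj, finrank_bot] at h1
    have h2 : _ ≤ Module.finrank ℝ S + _ := M.card_le_finrank_range_tension_tail
    have h3 : _ ≤ Module.finrank ℝ T + 1 := h.card_le_finrank_range_tension_left
    have h4 := M.two_mul_finrank_antisymm
    have h5 := h.euler
    rw [Nat.card_eq_fintype_card, Nat.card_eq_fintype_card, Nat.card_eq_fintype_card] at h5
    omega
  rw [← hST] at hk
  obtain ⟨_, ⟨p, rfl⟩, _, ⟨q, rfl⟩, rfl⟩ := Submodule.mem_sup.1 hk
  exact ⟨p, q, rfl⟩

variable {M} in
/-- On a plane graph a circulation is the tension of a face potential. -/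
theorem IsPlane.exists_face_potential [Finite V] [Fintype D] [Finite F] (h : M.IsPlane)
    {k : D → ℝ} (hk : k ∈ M.antisymm) (hcirc : ∀ p : V → ℝ, ∑ d, p (M.tail d) * k d = 0) :
    ∃ q : F → ℝ, ∀ d, k d = q (M.left d) - q (M.right d) := by
  obtain ⟨p, q, rfl⟩ := h.exists_potentials hk
  have h1 := M.sum_tension_mul M.tail p hk
  rw [hcirc, mul_zero] at h1
  simp only [Pi.add_apply, mul_add, Finset.sum_add_distrib,
    M.sum_tension_tail_mul_tension_left, add_zero] at h1
  rw [Finset.sum_eq_zero_iff_of_nonneg fun d _ => mul_self_nonneg _] at h1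
  refine ⟨q, fun d => ?_⟩
  rw [Pi.add_apply, mul_self_eq_zero.1 (h1 d (Finset.mem_univ d)), zero_add]
  rfl

variable {M} in
/-- On a plane graph a circulation in the dual graph is the tension of a vertex potential. -/
theorem IsPlane.exists_vertex_potential [Finite V] [Fintype D] [Finite F] (h : M.IsPlane)
    {k : D → ℝ} (hk : k ∈ M.antisymm) (hcirc : ∀ q : F → ℝ, ∑ d, q (M.left d) * k d = 0) :
    ∃ p : V → ℝ, ∀ d, k d = p (M.tail d) - p (M.head d) := by
  obtain ⟨p, q, rfl⟩ := h.exists_potentials hk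
  have h1 := M.sum_tension_mul M.left q hk
  rw [hcirc, mul_zero] at h1
  have h2 := M.sum_tension_tail_mul_tension_left p q
  simp only [mul_comm (M.tension M.tail p _)] at h2
  simp only [Pi.add_apply, mul_add, Finset.sum_add_distrib, h2, zero_add] at h1
  rw [Finset.sum_eq_zero_iff_of_nonneg fun d _ => mul_self_nonneg _] at h1
  refine ⟨p, fun d => ?_⟩
  rw [Pi.add_apply, mul_self_eq_zero.1 (h1 d (Finset.mem_univ d)), add_zero]
  rfl

theorem apply_eq_of_comp_rot_eq [Finite D] {X : Type*} {ν : D → X} (h : ∀ d, ν (M.rot d) = ν d)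
    {d d' : D} (hd : M.tail d = M.tail d') : ν d = ν d' := by
  obtain ⟨n, rfl⟩ := (M.rot_sameCycle d d' hd).exists_nat_pow_eq
  induction n with
  | zero => rfl
  | succ n ih =>
    rw [pow_succ', Equiv.Perm.mul_apply, h]
    exact ih (by rw [hd, pow_succ', Equiv.Perm.mul_apply, M.tail_rot])

variable {M} in
/-- A circulation `k` in the dual graph that stays in a set `A` of faces has a vertex potential that
extends continuously to the faces outside `A`: it takes the value `q a` at every vertex on the
boundary of such a face `a`. This holds even for the faces with a disconnected boundary, where the
values of an arbitrary potential of `k` on the components of the graph need an adjustment. -/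
theorem IsPlane.exists_potential_of_supported [Finite V] [Fintype D] [Finite F] (h : M.IsPlane)
    {k : D → ℝ} (hk : k ∈ M.antisymm) (hcirc : ∀ q : F → ℝ, ∑ d, q (M.left d) * k d = 0)
    (A : Set F) (hA : ∀ d, k d ≠ 0 → M.left d ∈ A) :
    ∃ (p : V → ℝ) (q : F → ℝ), (∀ d, k d = p (M.tail d) - p (M.head d)) ∧
      ∀ d, M.left d ∉ A → p (M.tail d) = q (M.left d) := by
  classical
  obtain ⟨p, hp⟩ := h.exists_vertex_potential hk hcirc
  -- `ν` lives on the corners; the corner of `d` lies between `d` and `rot.symm d`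
  let ν : D → ℝ := fun d => if M.left d ∈ A then p (M.tail d) else 0
  obtain ⟨q, hq⟩ : ∃ q : F → ℝ, ∀ d, ν (M.rot d) - ν d = q (M.left d) - q (M.right d) := by
    refine h.exists_face_potential (k := fun d => ν (M.rot d) - ν d) (fun d => ?_) fun p' => ?_
    · simp only [ν, M.left_rot, M.tail_rot, M.left_rev, M.right_rev, M.tail_rev]
      by_cases hd : k d = 0
      · rw [hp, sub_eq_zero] at hd
        rw [hd]
        by_cases h1 : M.left d ∈ A <;> by_cases h2 : M.right d ∈ A <;> simp [h1, h2]
      · have h1 := hA d hd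
        have h2 : M.right d ∈ A :=
          hA (M.rev d) (by rw [M.mem_antisymm.1 hk]; exact neg_ne_zero.2 hd)
        simp [h1, h2]
    · simp only [mul_sub, Finset.sum_sub_distrib]
      rw [← Equiv.sum_comp M.rot fun d => p' (M.tail d) * ν d]
      simp only [M.tail_rot, sub_self]
  -- `ν + q ∘ left` is constant around every vertex
  have hrot : ∀ d, ν (M.rot d) + q (M.left (M.rot d)) = ν d + q (M.left d) := by
    intro d
    rw [M.left_rot]; linarith [hq d]
  let P : V → ℝ := fun v =>
    if hv : ∃ d, M.tail d = v then ν hv.choose + q (M.left hv.choose) else 0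
  have hP : ∀ d, P (M.tail d) = ν d + q (M.left d) := by
    intro d
    have hv : ∃ d', M.tail d' = M.tail d := ⟨d, rfl⟩
    simp only [P, dif_pos hv]
    exact M.apply_eq_of_comp_rot_eq (ν := fun d => ν d + q (M.left d)) hrot hv.choose_spec
  refine ⟨P, q, fun d => ?_, fun d hd => ?_⟩
  · have h1 := hP (M.rot (M.rev d))
    rw [M.tail_rot, M.tail_rev, M.left_rot_rev] at h1
    rw [hP, h1]
    simp only [ν, M.left_rot_rev, M.tail_rot, M.tail_rev]
    by_cases hd : M.left d ∈ A
    · simp only [hd, if_true]; rw [hp]; ring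
    · have : k d = 0 := by
        by_contra h0
        exact hd (hA d h0)
      simp [hd, this]
  · rw [hP]; simp [ν, hd]

end EmbeddedGraph

/-! ### Flows without cycles in one direction -/

/-- A nonempty set that is closed under predecessors of a relation contains a strongly connected
set that is closed under predecessors. -/
theorem exists_stronglyConnected_subset {α : Type*} [Finite α] (r : α → α → Prop) {S : Set α}
    (hS : S.Nonempty) (hr : ∀ a b, r a b → b ∈ S → a ∈ S) :
    ∃ A ⊆ S, A.Nonempty ∧ (∀ a b, r a b → b ∈ A → a ∈ A) ∧
      ∀ a ∈ A, ∀ b ∈ A, Relation.ReflTransGen r a b := by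
  let P : α → Set α := fun b => {a | Relation.ReflTransGen r a b}
  obtain ⟨b, hb, hmin⟩ := S.toFinite.exists_minimalFor (fun b => (P b).ncard) S hS
  have hPS : ∀ a, Relation.ReflTransGen r a b → a ∈ S := fun a hab => by
    induction hab using Relation.ReflTransGen.head_induction_on with
    | refl => exact hb
    | head h _ ih => exact hr _ _ h ih
  refine ⟨P b, hPS, ⟨b, Relation.ReflTransGen.refl⟩,
    fun a c h hc => Relation.ReflTransGen.head h hc, fun a ha c hc => ?_⟩
  have hsub : P c ⊆ P b := fun d hd => Relation.ReflTransGen.trans hd hc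
  have heq : P c = P b :=
    Set.eq_of_subset_of_ncard_le hsub (hmin (hPS c hc) (Set.ncard_le_ncard hsub))
  have : a ∈ P c := heq ▸ ha
  exact this

namespace EmbeddedGraph

variable {V D F : Type*} (M : EmbeddedGraph V D F)

/-- A flow `g` through an embedded graph in which every vertex `v` of the set `ringed` is replaced
by a ring: `u x` is the net amount that flows on the ring clockwise from the place of the dart `x`
to the place of the next dart `M.rot x`, and `c v` bounds the oscillation of `u` around `v`
(if `u` lies between `-c v / 2` and `c v / 2`, for example). -/
structure IsRingFlow [Fintype D] (outer : F) (s t : V) (ringed : Set V) (c : V → ℝ)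
    (g u : D → ℝ) : Prop where
  nonneg : ∀ d, 0 ≤ g d
  rev_eq_zero : ∀ d, 0 < g d → g (M.rev d) = 0
  source : ∀ d, 0 < g d → M.head d ≠ s
  sink : (∃ d, M.tail d = t) → ∃ d, M.tail d = t ∧ M.left d = outer
  conserve : ∀ v, v ≠ s → v ≠ t → M.inflow g v = M.outflow g v
  ring : ∀ x, M.tail x ∈ ringed → u x = u (M.rot.symm x) + g (M.rev x) - g x
  ring_le : ∀ x y, M.tail x = M.tail y → M.tail x ∈ ringed → u x - u y ≤ c (M.tail x)

/-- A step in the dual graph from left to right across a dart whose reverse carries no flow. -/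
def FreeStep (g : D → ℝ) (a b : F) : Prop :=
  ∃ d, M.left d = a ∧ M.right d = b ∧ g (M.rev d) = 0

/-- A step in the dual graph that crosses the ring at a vertex `v` twice, at two edges between which
`u` drops by `c v`. If `u` lies between `-c v / 2` and `c v / 2`, it leads inwards across an edge that
is saturated clockwise and outwards across an edge that is saturated counterclockwise. -/
def RingStep (ringed : Set V) (c : V → ℝ) (u : D → ℝ) (a b : F) : Prop :=
  ∃ x y, M.tail x = M.tail y ∧ M.tail x ∈ ringed ∧ M.right x = a ∧ M.right y = b ∧
    u x - u y = c (M.tail x)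

/-- The antisymmetric function that counts one crossing of the dart `e` from left to right. -/
def crossing [DecidableEq D] (e d : D) : ℝ :=
  (if d = e then 1 else 0) - if d = M.rev e then 1 else 0

theorem crossing_self [DecidableEq D] (e : D) : M.crossing e e = 1 := by
  simp [crossing, (M.rev_ne e).symm]

theorem crossing_mem_antisymm [DecidableEq D] (e : D) : M.crossing e ∈ M.antisymm := by
  intro d
  have h1 : M.rev d = e ↔ d = M.rev e :=
    ⟨fun h => by rw [← h, M.rev_rev], fun h => by rw [h, M.rev_rev]⟩
  have h2 : M.rev d = M.rev e ↔ d = e :=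
    ⟨fun h => by rw [← M.rev_rev d, h, M.rev_rev], fun h => by rw [h]⟩
  simp only [crossing, h1, h2]; ring

theorem crossing_nonneg [DecidableEq D] {e d : D} (h : d ≠ M.rev e) : 0 ≤ M.crossing e d := by
  simp only [crossing, h, if_false, sub_zero]; split_ifs <;> norm_num

theorem eq_or_eq_of_crossing_ne_zero [DecidableEq D] {e d : D} (h : M.crossing e d ≠ 0) :
    d = e ∨ d = M.rev e := by
  by_contra! hne
  simp [crossing, hne.1, hne.2] at h

theorem sum_mul_crossing [Fintype D] [DecidableEq D] (p : D → ℝ) (e : D) :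
    ∑ d, p d * M.crossing e d = p e - p (M.rev e) := by
  simp [crossing, mul_sub, Finset.sum_sub_distrib]

/-- A free step or a ring step. -/
def Step (ringed : Set V) (c : V → ℝ) (g u : D → ℝ) (a b : F) : Prop :=
  M.FreeStep g a b ∨ M.RingStep ringed c u a b

/-- A path of free steps in a set `A` of faces, as an antisymmetric function that counts the
crossings of every dart. -/
theorem exists_crossing_function [Fintype D] {g : D → ℝ} {A : Set F}
    (hA : ∀ a b, M.FreeStep g a b → b ∈ A → a ∈ A) {a b : F} (hb : b ∈ A)
    (hab : Relation.ReflTransGen (M.FreeStep g) a b) :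
    ∃ k ∈ M.antisymm, (∀ d, 0 < g d → 0 ≤ k d) ∧ (∀ d, k d ≠ 0 → M.left d ∈ A) ∧
      ∀ q : F → ℝ, ∑ d, q (M.left d) * k d = q a - q b := by
  classical
  suffices h : a ∈ A ∧ ∃ k ∈ M.antisymm, (∀ d, 0 < g d → 0 ≤ k d) ∧
      (∀ d, k d ≠ 0 → M.left d ∈ A) ∧ ∀ q : F → ℝ, ∑ d, q (M.left d) * k d = q a - q b from h.2
  induction hab using Relation.ReflTransGen.head_induction_on with
  | refl => exact ⟨hb, 0, Submodule.zero_mem _, fun _ _ => le_rfl, by simp, by simp⟩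
  | @head a a' h _ ih =>
    obtain ⟨ha', k, hk, hpos, hkA, hsum⟩ := ih
    have ha : a ∈ A := hA _ _ h ha'
    obtain ⟨e, rfl, rfl, he⟩ := h
    refine ⟨ha, k + M.crossing e, Submodule.add_mem _ hk (M.crossing_mem_antisymm e),
      fun d hd => ?_, fun d hd => ?_, fun q => ?_⟩
    · exact add_nonneg (hpos d hd) (M.crossing_nonneg (by rintro rfl; exact hd.ne' he))
    · by_cases h0 : k d = 0
      · rw [Pi.add_apply, h0, zero_add] at hd
        rcases M.eq_or_eq_of_crossing_ne_zero hd with rfl | rfl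
        exacts [ha, ha']
      · exact hkA d h0
    · simp only [Pi.add_apply, mul_add, Finset.sum_add_distrib, hsum]
      rw [M.sum_mul_crossing fun d => q (M.left d), M.left_rev]
      ring

namespace IsRingFlow

variable {M} [Fintype D] {outer : F} {s t : V} {ringed : Set V} {c : V → ℝ} {g u : D → ℝ}

/-- Where a ring step enters a set of faces that no free step enters, some flow leaves the vertex
into the interior of the set. Indeed, go counterclockwise around the vertex from the end of the step.
As long as the flow on the darts is not outgoing, `u` does not increase; and the dart at which one
leaves the set carries flow to the vertex, so that `u` would fall below its minimum there. -/
theorem exists_dart_of_ringStep (h : M.IsRingFlow outer s t ringed c g u) {A : Set F}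
    (hA : ∀ a b, M.FreeStep g a b → b ∈ A → a ∈ A) {x y : D} (hxy : M.tail x = M.tail y)
    (hx : M.tail x ∈ ringed) (hxA : M.right x ∉ A) (hyA : M.right y ∈ A)
    (hu : u x - u y = c (M.tail x)) :
    ∃ e, M.tail e = M.tail x ∧ 0 < g e ∧ M.left e ∈ A ∧ M.right e ∈ A := by
  by_contra! hne
  have key : ∀ n : ℕ, M.tail ((M.rot.symm ^ n) y) = M.tail x ∧
      M.right ((M.rot.symm ^ n) y) ∈ A ∧ u ((M.rot.symm ^ n) y) ≤ u y := by
    intro n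
    induction n with
    | zero => exact ⟨hxy.symm, hyA, le_rfl⟩
    | succ n ih =>
      rw [pow_succ', Equiv.Perm.mul_apply]
      set e := (M.rot.symm ^ n) y
      obtain ⟨h1, h2, h3⟩ := ih
      have h4 := h.ring e (h1 ▸ hx)
      have h5 := h.nonneg (M.rev e)
      rw [M.tail_rot_symm, M.right_rot_symm]
      by_cases hl : M.left e ∈ A
      · have h6 : g e ≤ 0 := not_lt.1 fun h6 => hne e h1 h6 hl h2
        exact ⟨h1, hl, by linarith⟩
      · have h6 : g (M.rev e) ≠ 0 := fun h6 => hl (hA _ _ ⟨e, rfl, rfl, h6⟩ h2)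
        have h7 := h.rev_eq_zero _ (lt_of_le_of_ne h5 h6.symm)
        rw [M.rev_rev] at h7
        have h8 := h.ring_le x (M.rot.symm e) (by rw [M.tail_rot_symm, h1]) hx
        have h9 := lt_of_le_of_ne h5 h6.symm
        linarith
  obtain ⟨n, hn⟩ := (M.mirror.rot_sameCycle y x hxy.symm).exists_nat_pow_eq
  exact hxA (hn ▸ (key n).2.1)

/-- A flow cannot go down a vertex potential whose value at the sink is the value at the tail of an
arc on which the potential decreases strictly: what passes that arc would be trapped in the set of
vertices that the flow reaches afterwards. -/
theorem potential_tail_le_head [Finite V] (h : M.IsRingFlow outer s t ringed c g u) {p : V → ℝ}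
    (hp : ∀ d, 0 < g d → p (M.head d) ≤ p (M.tail d)) {e : D} (he : 0 < g e)
    (ht : (∃ d, M.tail d = t) → p t = p (M.tail e)) : p (M.tail e) ≤ p (M.head e) := by
  classical
  cases nonempty_fintype V
  by_contra! hlt
  let R : Set V := {v | Relation.ReflTransGen
    (fun v w => ∃ d, 0 < g d ∧ M.tail d = v ∧ M.head d = w) (M.head e) v}
  have hR : ∀ v ∈ R, p v ≤ p (M.head e) ∧ v ≠ s ∧ ∃ d, M.tail d = v := by
    intro v hv
    induction hv with
    | refl => exact ⟨le_rfl, h.source e he, M.rev e, rfl⟩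
    | tail _ hd ih =>
      obtain ⟨d, hd, rfl, rfl⟩ := hd
      exact ⟨(hp d hd).trans ih.1, h.source d hd, M.rev d, rfl⟩
  have hRt : t ∉ R := fun hv => by
    obtain ⟨h1, _, h2⟩ := hR t hv
    rw [ht h2] at h1
    exact hlt.not_ge h1
  let ι : V → ℝ := fun v => if v ∈ R then 1 else 0
  have hzero : ∑ d, (ι (M.head d) - ι (M.tail d)) * g d = 0 := by
    have h1 : ∑ v, ι v * M.inflow g v = ∑ v, ι v * M.outflow g v := by
      refine Finset.sum_congr rfl fun v _ => ?_
      by_cases hv : v ∈ R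
      · rw [h.conserve v (hR v hv).2.1 (fun h => hRt (h ▸ hv))]
      · simp [ι, hv]
    simp only [M.inflow_eq_outflow_rev, sum_mul_outflow] at h1
    rw [← M.sum_comp_rev] at h1
    simp only [M.rev_rev, M.tail_rev] at h1
    simp only [sub_mul, Finset.sum_sub_distrib, h1, sub_self]
  have hnonneg : ∀ d ∈ Finset.univ, 0 ≤ (ι (M.head d) - ι (M.tail d)) * g d := by
    intro d _
    rcases (h.nonneg d).eq_or_lt with h0 | h0
    · rw [← h0, mul_zero]
    · refine mul_nonneg ?_ h0.le
      by_cases hv : M.tail d ∈ R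
      · have : M.head d ∈ R := Relation.ReflTransGen.tail hv ⟨d, h0, rfl, rfl⟩
        simp [ι, hv, this]
      · simp only [ι, hv, if_false, sub_zero]; split_ifs <;> norm_num
  rw [Finset.sum_eq_zero_iff_of_nonneg hnonneg] at hzero
  have h1 := hzero e (Finset.mem_univ e)
  have h2 : M.head e ∈ R := Relation.ReflTransGen.refl
  have h3 : M.tail e ∉ R := fun hv => hlt.not_ge (hR _ hv).1
  simp [ι, h2, h3, he.ne'] at h1

/-- If the infinite face reaches every face by free steps and ring steps, then the flow has no
counterclockwise cycle; and more generally no circulation with arcs in the support of the flow has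
a face potential that is somewhere larger than on the infinite face. -/
theorem potential_le_outer [Finite V] [Finite F] (hM : M.IsPlane)
    (h : M.IsRingFlow outer s t ringed c g u)
    (hreach : ∀ a, Relation.ReflTransGen (M.Step ringed c g u) outer a)
    {ψ : F → ℝ} (hψ : ∀ d, ψ (M.right d) < ψ (M.left d) → 0 < g d) (a : F) :
    ψ a ≤ ψ outer := by
  classical
  by_contra! ha
  have : Nonempty F := ⟨a⟩
  obtain ⟨m, hm⟩ := Finite.exists_max ψ
  -- no free step enters the set of the maxima of `ψ`
  obtain ⟨A, hAm, ⟨a₀, ha₀⟩, hA, hconn⟩ := exists_stronglyConnected_subset (M.FreeStep g)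
    (S := {a | ψ a = ψ m}) ⟨m, rfl⟩ (by
      rintro _ _ ⟨d, rfl, rfl, hd⟩ hb
      refine (hm _).antisymm (not_lt.1 fun hlt => ?_)
      have := hψ (M.rev d) (by rw [M.right_rev, M.left_rev]; exact hlt.trans_eq hb.symm)
      exact this.ne' hd)
  have hout : outer ∉ A := fun ho => by
    have : ψ outer = ψ m := hAm ho
    exact (ha.trans_le (hm a)).ne this
  -- the first step of a path from the infinite face into `A`
  obtain ⟨b, b', hb, hb', hpath, hstep⟩ : ∃ b b', b ∉ A ∧ b' ∈ A ∧
      Relation.ReflTransGen (fun a b => b ∉ A ∧ M.Step ringed c g u a b) outer b ∧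
      M.Step ringed c g u b b' := by
    by_contra! hne
    have key : ∀ a, Relation.ReflTransGen (M.Step ringed c g u) outer a → a ∉ A ∧
        Relation.ReflTransGen (fun a b => b ∉ A ∧ M.Step ringed c g u a b) outer a := by
      intro a ha
      induction ha with
      | refl => exact ⟨hout, Relation.ReflTransGen.refl⟩
      | @tail b b' _ hs ih =>
        have hb' : b' ∉ A := fun hb' => hne b b' ih.1 hb' ih.2 hs
        exact ⟨hb', ih.2.tail ⟨hb', hs⟩⟩
    exact (key a₀ (hreach a₀)).1 ha₀
  obtain ⟨x, y, hxy, hx, rfl, rfl, hu⟩ :=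
    Or.resolve_left hstep fun hs => hb (hA _ _ hs hb')
  obtain ⟨e, hev, he, hel, her⟩ := h.exists_dart_of_ringStep hA hxy hx hb hb' hu
  -- a closed walk in `A` that crosses `e` from left to right and returns by free steps
  obtain ⟨k, hk, hkpos, hkA, hksum⟩ := M.exists_crossing_function hA hel (hconn _ her _ hel)
  have hrev : g (M.rev e) = 0 := h.rev_eq_zero e he
  obtain ⟨p, q, hp, hq⟩ := hM.exists_potential_of_supported (k := k + M.crossing e)
    (Submodule.add_mem _ hk (M.crossing_mem_antisymm e))
    (fun q => by
      simp only [Pi.add_apply, mul_add, Finset.sum_add_distrib, hksum]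
      rw [M.sum_mul_crossing fun d => q (M.left d), M.left_rev]
      ring) A
    (fun d hd => by
      by_cases h0 : k d = 0
      · rw [Pi.add_apply, h0, zero_add] at hd
        rcases M.eq_or_eq_of_crossing_ne_zero hd with rfl | rfl
        exacts [hel, her]
      · exact hkA d h0)
  -- along the path from the infinite face, `q` does not change
  have hqstep : ∀ x y, M.tail x = M.tail y → M.right x ∉ A → M.right y ∉ A →
      q (M.right x) = q (M.right y) := by
    intro x y hxy hx hy
    have h1 := hq (M.rot x) (by rwa [M.left_rot])
    have h2 := hq (M.rot y) (by rwa [M.left_rot])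
    rw [M.tail_rot, M.left_rot] at h1 h2
    rw [← h1, ← h2, hxy]
  have hqx : M.right x ∉ A ∧ q (M.right x) = q outer := by
    generalize M.right x = b at hpath
    induction hpath with
    | refl => exact ⟨hout, rfl⟩
    | tail _ hs ih =>
      obtain ⟨hb', hs⟩ := hs
      refine ⟨hb', Eq.trans ?_ ih.2⟩
      rcases hs with ⟨d, rfl, rfl, _⟩ | ⟨x, y, hxy, _, rfl, rfl, _⟩
      · have := hqstep d (M.rot.symm d) (M.tail_rot_symm d).symm hb'
          (by rw [M.right_rot_symm]; exact ih.1)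
        rwa [M.right_rot_symm] at this
      · exact hqstep y x hxy.symm hb' ih.1
  have hpe : p (M.tail e) = q outer := by
    have h1 := hq (M.rot x) (by rw [M.left_rot]; exact hb)
    rw [M.tail_rot, M.left_rot] at h1
    rw [hev, h1, hqx.2]
  have hle := h.potential_tail_le_head (p := p) (e := e) (fun d hd => by
    have h1 := add_nonneg (hkpos d hd)
      (M.crossing_nonneg (e := e) (d := d) (by rintro rfl; exact hd.ne' hrev))
    have h2 := hp d
    rw [Pi.add_apply] at h2
    linarith) he (fun ht => by
      obtain ⟨d, rfl, hd⟩ := h.sink ht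
      rw [hpe, hq d (hd ▸ hout), hd])
  have h1 := hp e
  rw [Pi.add_apply, M.crossing_self] at h1
  linarith [hkpos e he]

end IsRingFlow
/-! ### Distances in the dual graph and the cancellation procedure -/

/-- Every ordered pair of faces is joined by a path in the dual graph. -/
def DualReachable : Prop := ∀ a b, ∃ p, M.IsDualPath a p b

/-- `φ` satisfies the triangle inequality for the lengths `len` of the dual arcs. -/
def IsFeasible (len : D → ℝ) (φ : F → ℝ) : Prop := ∀ d, φ (M.right d) ≤ φ (M.left d) + len d

theorem IsDualPath.append_singleton {M : EmbeddedGraph V D F} {a : F} {p : List D} {d : D}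
    (h : M.IsDualPath a p (M.left d)) : M.IsDualPath a (p ++ [d]) (M.right d) := by
  induction p generalizing a with
  | nil => exact ⟨h.symm, rfl⟩
  | cons e p ih => exact ⟨h.1, ih h.2⟩

theorem dualReachable_of_eqvGen
    (h : ∀ a b : F, Relation.EqvGen (fun a b => ∃ d, M.left d = a ∧ M.right d = b) a b) :
    M.DualReachable := by
  let r : F → F → Prop := fun a b => ∃ d, M.left d = a ∧ M.right d = b
  have hr : ∀ a b, r a b → r b a := by
    rintro _ _ ⟨d, rfl, rfl⟩
    exact ⟨M.rev d, M.left_rev d, M.right_rev d⟩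
  have key : ∀ a b, Relation.EqvGen r a b →
      Relation.ReflTransGen r a b ∧ Relation.ReflTransGen r b a := by
    intro a b hab
    induction hab with
    | rel a b h => exact ⟨.single h, .single (hr _ _ h)⟩
    | refl => exact ⟨.refl, .refl⟩
    | symm _ _ _ ih => exact ih.symm
    | trans _ _ _ _ _ ih1 ih2 => exact ⟨ih1.1.trans ih2.1, ih2.2.trans ih1.2⟩
  intro a b
  have hab := (key a b (h a b)).1
  induction hab with
  | refl => exact ⟨[], rfl⟩
  | tail _ hd ih =>
    obtain ⟨p, hp⟩ := ih
    obtain ⟨d, rfl, rfl⟩ := hd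
    exact ⟨p ++ [d], hp.append_singleton⟩

theorem IsFeasible.le_sum {M : EmbeddedGraph V D F} {len : D → ℝ} {φ : F → ℝ}
    (h : M.IsFeasible len φ) {a b : F} {p : List D} (hp : M.IsDualPath a p b) :
    φ b ≤ φ a + (p.map len).sum := by
  induction p generalizing a with
  | nil => rw [show a = b from hp]; simp
  | cons d p ih =>
    obtain ⟨rfl, hp⟩ := hp
    have := h d
    rw [List.map_cons, List.sum_cons]
    linarith [ih hp]

section Distance

variable {M} {len : D → ℝ}

theorem dualDist_le_sum (hlen : ∀ d, 0 ≤ len d) {a b : F} {p : List D}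
    (hp : M.IsDualPath a p b) : M.dualDist len a b ≤ (p.map len).sum := by
  refine csInf_le ⟨0, ?_⟩ ⟨p, hp, rfl⟩
  rintro _ ⟨p, -, rfl⟩
  exact List.sum_nonneg fun x hx => by
    obtain ⟨d, -, rfl⟩ := List.mem_map.1 hx
    exact hlen d

theorem IsFeasible.le_dualDist (hM : M.DualReachable) {φ : F → ℝ} (h : M.IsFeasible len φ)
    (a b : F) : φ b ≤ φ a + M.dualDist len a b := by
  have hle : φ b - φ a ≤ M.dualDist len a b := by
    obtain ⟨p, hp⟩ := hM a b
    refine le_csInf ⟨_, p, hp, rfl⟩ ?_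
    rintro _ ⟨p, hp, rfl⟩
    linarith [h.le_sum hp]
  linarith

theorem dualDist_self (hM : M.DualReachable) (hlen : ∀ d, 0 ≤ len d) (a : F) :
    M.dualDist len a a = 0 := by
  refine le_antisymm (dualDist_le_sum hlen (p := []) rfl) ?_
  have h0 : M.IsFeasible len fun _ => 0 := fun d => by simpa using hlen d
  simpa using h0.le_dualDist hM a a

theorem isFeasible_dualDist (hM : M.DualReachable) (hlen : ∀ d, 0 ≤ len d) (a : F) :
    M.IsFeasible len (M.dualDist len a) := by
  intro d
  have hle : M.dualDist len a (M.right d) - len d ≤ M.dualDist len a (M.left d) := by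
    obtain ⟨p, hp⟩ := hM a (M.left d)
    refine le_csInf ⟨_, p, hp, rfl⟩ ?_
    rintro _ ⟨p, hp, rfl⟩
    have := dualDist_le_sum hlen hp.append_singleton
    simp only [List.map_append, List.sum_append, List.map_cons, List.map_nil, List.sum_cons,
      List.sum_nil, add_zero] at this
    linarith
  linarith

/-- Every face is reached from `a` by darts on which the triangle inequality for the distance
from `a` is an equality. Otherwise the potential could be raised on the faces that are not reached,
and the distances are the largest feasible potential. -/
theorem reflTransGen_tight [Finite D] (hM : M.DualReachable) (hlen : ∀ d, 0 ≤ len d) (a b : F) :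
    Relation.ReflTransGen (fun b b' => ∃ d, M.left d = b ∧ M.right d = b' ∧
      M.dualDist len a (M.right d) = M.dualDist len a (M.left d) + len d) a b := by
  classical
  set φ := M.dualDist len a
  have hφ : M.IsFeasible len φ := isFeasible_dualDist hM hlen a
  by_contra hb
  let T : Set F := {b | Relation.ReflTransGen (fun b b' => ∃ d, M.left d = b ∧ M.right d = b' ∧
      φ (M.right d) = φ (M.left d) + len d) a b}
  have hslack : ∀ d, M.left d ∈ T → M.right d ∉ T → φ (M.right d) < φ (M.left d) + len d :=
    fun d h1 h2 => lt_of_le_of_ne (hφ d) fun h =>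
      h2 (Relation.ReflTransGen.tail h1 ⟨d, rfl, rfl, h⟩)
  obtain ⟨ε, hε, hεd⟩ : ∃ ε > 0, ∀ d, M.left d ∈ T → M.right d ∉ T →
      φ (M.right d) + ε ≤ φ (M.left d) + len d := by
    rcases isEmpty_or_nonempty D with hD | hD
    · exact ⟨1, one_pos, fun d => (IsEmpty.false d).elim⟩
    · let σ : D → ℝ := fun d => if M.left d ∈ T ∧ M.right d ∉ T then
        φ (M.left d) + len d - φ (M.right d) else 1
      obtain ⟨m, hm⟩ := Finite.exists_min σ
      refine ⟨σ m, ?_, fun d h1 h2 => ?_⟩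
      · simp only [σ]
        split_ifs with h
        · linarith [hslack m h.1 h.2]
        · exact one_pos
      · have : σ d = φ (M.left d) + len d - φ (M.right d) := by simp [σ, h1, h2]
        linarith [hm d]
  have hfeas : M.IsFeasible len fun b => φ b + if b ∈ T then 0 else ε := by
    intro d
    have h1 := hφ d
    by_cases hl : M.left d ∈ T <;> by_cases hr : M.right d ∈ T
    · simp only [hl, hr, if_true]; linarith
    · simp only [hl, hr, if_true, if_false]; linarith [hεd d hl hr]
    · simp only [hl, hr, if_true, if_false]; linarith
    · simp only [hl, hr, if_false]; linarith
  have haT : a ∈ T := Relation.ReflTransGen.refl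
  have hbT : b ∉ T := hb
  have h1 := hfeas.le_dualDist hM a b
  have h2 : φ a = 0 := dualDist_self hM hlen a
  simp only [haT, hbT, if_true, if_false, h2] at h1
  linarith

end Distance

section Cancel

variable {M} {outer : F} {c f : D → ℝ}

theorem cancelClockwise_eq (d : D) : M.cancelClockwise outer c f d =
    max 0 (f d - f (M.rev d) + (M.dualDist (M.residual c f) outer (M.right d) -
      M.dualDist (M.residual c f) outer (M.left d))) := by
  have key : ∀ a b : ℝ, max 0 (a - b) - max 0 (b - a) = a - b := by
    intro a b
    rcases le_total a b with h | h
    · rw [max_eq_left (by linarith), max_eq_right (by linarith)]; ring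
    · rw [max_eq_right (by linarith), max_eq_left (by linarith)]; ring
  simp only [cancelClockwise, circulation, M.right_rev, M.left_rev]
  congr 1
  linarith [key (M.dualDist (M.residual c f) outer (M.right d))
    (M.dualDist (M.residual c f) outer (M.left d))]

theorem cancelClockwise_nonneg (d : D) : 0 ≤ M.cancelClockwise outer c f d := le_max_left _ _

theorem cancelClockwise_sub_rev (d : D) :
    M.cancelClockwise outer c f d - M.cancelClockwise outer c f (M.rev d) =
      f d - f (M.rev d) + (M.dualDist (M.residual c f) outer (M.right d) -
        M.dualDist (M.residual c f) outer (M.left d)) := by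
  simp only [cancelClockwise_eq, M.right_rev, M.left_rev, M.rev_rev]
  set x := f d - f (M.rev d) + (M.dualDist (M.residual c f) outer (M.right d) -
    M.dualDist (M.residual c f) outer (M.left d)) with hx
  have : f (M.rev d) - f d + (M.dualDist (M.residual c f) outer (M.left d) -
    M.dualDist (M.residual c f) outer (M.right d)) = -x := by rw [hx]; ring
  rw [this]
  rcases le_total 0 x with h | h
  · rw [max_eq_right h, max_eq_left (by linarith)]; ring
  · rw [max_eq_left h, max_eq_right (by linarith)]; ring

theorem cancelClockwise_rev_eq_zero {d : D} (h : 0 < M.cancelClockwise outer c f d) :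
    M.cancelClockwise outer c f (M.rev d) = 0 := by
  have h1 := cancelClockwise_sub_rev (M := M) (outer := outer) (c := c) (f := f) d
  rw [cancelClockwise_eq] at h h1 ⊢
  rw [cancelClockwise_eq] at h1
  have h2 := lt_max_iff.1 h
  have h3 := h2.resolve_left (lt_irrefl _)
  rw [max_eq_right h3.le] at h1
  linarith

theorem residual_nonneg (hf : ∀ d, 0 ≤ f d) (hfc : ∀ d, f d ≤ c d) (d : D) : 0 ≤ M.residual c f d := by
  have h1 := hfc d
  have h2 := hf (M.rev d)
  rw [residual]; linarith

theorem cancelClockwise_le (hM : M.DualReachable) (hf : ∀ d, 0 ≤ f d)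
    (hfc : ∀ d, f d ≤ c d) (d : D) :
    M.cancelClockwise outer c f d ≤ c d := by
  rw [cancelClockwise_eq]
  refine max_le ((hf d).trans (hfc d)) ?_
  have := isFeasible_dualDist hM (residual_nonneg (M := M) hf hfc) outer d
  rw [residual] at this
  linarith

/-- After the procedure, every face is reached from the infinite face across saturated darts. -/
theorem reflTransGen_saturated [Finite D] (hM : M.DualReachable) (hf : ∀ d, 0 ≤ f d)
    (hfc : ∀ d, f d ≤ c d) (a : F) :
    Relation.ReflTransGen (fun b b' => ∃ d, M.left d = b ∧ M.right d = b' ∧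
      M.cancelClockwise outer c f d - M.cancelClockwise outer c f (M.rev d) = c d) outer a := by
  refine Relation.ReflTransGen.mono ?_ _ _
    (reflTransGen_tight hM (residual_nonneg (M := M) hf hfc) outer a)
  rintro _ _ ⟨d, rfl, rfl, hd⟩
  refine ⟨d, rfl, rfl, ?_⟩
  rw [cancelClockwise_sub_rev, hd, residual]
  ring

/-- The procedure does not change the net flow through a vertex. -/
theorem inflow_sub_outflow_cancelClockwise [Fintype D] (v : V) :
    M.inflow (M.cancelClockwise outer c f) v - M.outflow (M.cancelClockwise outer c f) v =
      M.inflow f v - M.outflow f v := by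
  set φ := M.dualDist (M.residual c f) outer
  have h0 : M.outflow (fun d => φ (M.left (M.rot d))) v = M.outflow (fun d => φ (M.left d)) v :=
    M.outflow_comp_rot (fun d => φ (M.left d)) v
  rw [inflow_eq_outflow_rev, inflow_eq_outflow_rev, ← outflow_sub, ← outflow_sub]
  have h1 : (fun d => M.cancelClockwise outer c f (M.rev d) - M.cancelClockwise outer c f d) =
      fun d => (f (M.rev d) - f d) - (φ (M.left (M.rot d)) - φ (M.left d)) := by
    ext d
    have := cancelClockwise_sub_rev (M := M) (outer := outer) (c := c) (f := f) d
    rw [M.left_rot]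
    linarith
  rw [h1, outflow_sub, outflow_sub (g := fun d => φ (M.left d)), h0, sub_self, sub_zero]

end Cancel

end EmbeddedGraph

namespace EmbeddedGraph

variable {V D F : Type*} {M : EmbeddedGraph V D F}

/-! ### Mirror images and cycles -/

/-- In the mirror image the ring from the place of `x` to the next place is the one from the place of
`M.rot.symm x` to that of `x`, in the opposite direction. -/
theorem IsRingFlow.mirror [Fintype D] {outer : F} {s t : V} {ringed : Set V} {c : V → ℝ}
    {g u : D → ℝ} (h : M.IsRingFlow outer s t ringed c g u) :
    M.mirror.IsRingFlow outer s t ringed c g fun x => -u (M.rot.symm x) where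
  nonneg := h.nonneg
  rev_eq_zero := h.rev_eq_zero
  source := h.source
  sink ht := by
    obtain ⟨d, hd, hd'⟩ := h.sink ht
    exact ⟨M.rot.symm d, (M.tail_rot_symm d).trans hd, (M.right_rot_symm d).trans hd'⟩
  conserve := h.conserve
  ring x hx := by
    have h1 := h.ring x hx
    change -u (M.rot.symm x) = -u (M.rot.symm (M.rot x)) + g (M.rev x) - g x
    rw [Equiv.symm_apply_apply]
    linarith
  ring_le x y hxy hx := by
    change M.tail x = M.tail y at hxy
    change M.tail x ∈ ringed at hx
    have h1 := h.ring_le (M.rot.symm y) (M.rot.symm x)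
      (by rw [M.tail_rot_symm, M.tail_rot_symm, hxy]) (by rwa [M.tail_rot_symm, ← hxy])
    rw [M.tail_rot_symm, ← hxy] at h1
    change _ ≤ c (M.tail x)
    linarith

/-- On a plane graph a directed cycle that never uses both directions of a curve has a nonconstant
face potential. -/
theorem IsPlane.exists_potential_of_cycle [Finite V] [Fintype D] [Finite F] (hM : M.IsPlane)
    {n : ℕ} [NeZero n] (e : ZMod n → D) (he : ∀ i, M.head (e i) = M.tail (e (i + 1)))
    (hrev : ∀ i j, e i ≠ M.rev (e j)) :
    ∃ ψ : F → ℝ, (∀ d, ψ (M.right d) < ψ (M.left d) → ∃ i, e i = d) ∧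
      ∃ d, ψ (M.right d) < ψ (M.left d) := by
  classical
  have : Fintype (ZMod n) := ZMod.fintype n
  obtain ⟨ψ, hψ⟩ := hM.exists_face_potential (k := ∑ i, M.crossing (e i))
    (Submodule.sum_mem _ fun i _ => M.crossing_mem_antisymm (e i)) fun p => by
      simp only [Finset.sum_apply, Finset.mul_sum]
      rw [Finset.sum_comm]
      simp only [M.sum_mul_crossing fun d => p (M.tail d), M.tail_rev, he,
        Finset.sum_sub_distrib]
      exact sub_eq_zero.2
        (Equiv.sum_comp (Equiv.addRight (1 : ZMod n)) fun i => p (M.tail (e i))).symm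
  simp only [Finset.sum_apply] at hψ
  refine ⟨ψ, fun d hd => ?_, e 0, ?_⟩
  · by_contra! hne
    have : ∑ i, M.crossing (e i) d ≤ 0 := Finset.sum_nonpos fun i _ => by
      simp only [crossing, (hne i).symm, if_false]
      split_ifs <;> norm_num
    linarith [hψ d]
  · have h1 : M.crossing (e 0) (e 0) ≤ ∑ i, M.crossing (e i) (e 0) :=
      Finset.single_le_sum (f := fun i => M.crossing (e i) (e 0))
        (fun i _ => M.crossing_nonneg (hrev 0 i)) (Finset.mem_univ 0)
    rw [M.crossing_self] at h1
    linarith [hψ (e 0)]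

end EmbeddedGraph

namespace PlanarNetwork

variable {V D F : Type*} (G : PlanarNetwork V D F)

/-! ### Flows in the extended graph -/

section Dual

variable [Finite D]

theorem ext_eqvGen (a b : G.ExtFace) :
    Relation.EqvGen (fun a b => ∃ d, G.ext.left d = a ∧ G.ext.right d = b) a b := by
  have hold : ∀ a b : F, Relation.EqvGen
      (fun a b => ∃ d, G.ext.left d = a ∧ G.ext.right d = b) (.old a) (.old b) := by
    intro a b
    have hab := G.isPlane.dual_connected a b
    induction hab with
    | rel a b h =>
      obtain ⟨d, rfl, rfl⟩ := h
      exact .rel _ _ ⟨.old d, rfl, rfl⟩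
    | refl => exact .refl _
    | symm _ _ _ ih => exact .symm _ _ ih
    | trans _ _ _ _ _ ih1 ih2 => exact .trans _ _ _ ih1 ih2
  have hface : ∀ a : G.ExtFace, ∃ b : F, Relation.EqvGen
      (fun a b => ∃ d, G.ext.left d = a ∧ G.ext.right d = b) a (.old b) := by
    rintro (a | ⟨_, hv, d, rfl⟩)
    · exact ⟨a, .refl _⟩
    · exact ⟨G.right d, .rel _ _ ⟨.ring ⟨d, hv⟩ false, rfl, rfl⟩⟩
  obtain ⟨a', ha⟩ := hface a
  obtain ⟨b', hb⟩ := hface b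
  exact (ha.trans _ _ _ (hold a' b')).trans _ _ _ (hb.symm _ _)

theorem ext_dualReachable : G.ext.DualReachable :=
  G.ext.dualReachable_of_eqvGen G.ext_eqvGen

theorem ext_mirror_dualReachable : G.ext.mirror.DualReachable := by
  refine G.ext.mirror.dualReachable_of_eqvGen fun a b => (G.ext_eqvGen a b).mono ?_
  rintro _ _ ⟨d, rfl, rfl⟩
  exact ⟨G.ext.rev d, G.ext.right_rev d, G.ext.mirror_right (G.ext.rev d)⟩

end Dual

/-- The net amount that flows clockwise on the ring from the place of `x` to the next place (and `0`
if the tail of `x` is not replaced by a ring). -/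
noncomputable def ringFlow (f : G.ExtDart → ℝ) (x : D) : ℝ :=
  open scoped Classical in
  if h : G.vertexCap (G.tail x) ≠ ∞ then f (.ring ⟨x, h⟩ true) - f (.ring ⟨x, h⟩ false) else 0

variable {G} {f : G.ExtDart → ℝ}

theorem ringFlow_slot (x : G.Slot) :
    G.ringFlow f x.1 = f (.ring x true) - f (.ring x false) := dif_pos x.2

theorem extTail_eq_old_iff {v : V} {hv : G.vertexCap v = ∞} {d : G.ExtDart} :
    G.extTail d = .old v hv ↔ ∃ a, .old a = d ∧ G.tail a = v := by
  constructor
  · rcases d with d | ⟨x, _ | _⟩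
    · by_cases hd : G.vertexCap (G.tail d) = ∞
      · intro h
        simp only [extTail, hd, dite_true, ExtVertex.old.injEq] at h
        exact ⟨d, rfl, h⟩
      · simp [extTail, hd]
    · simp [extTail]
    · simp [extTail]
  · rintro ⟨a, rfl, rfl⟩
    simp [extTail, hv]

theorem extTail_eq_slot_iff {x : G.Slot} {d : G.ExtDart} :
    G.extTail d = .slot x ↔ d = .old x.1 ∨ d = .ring x true ∨ d = .ring (Slot.prev x) false := by
  have hx : G.vertexCap (G.tail x.1) ≠ ∞ := x.2
  constructor
  · rcases d with d | ⟨y, _ | _⟩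
    · by_cases hd : G.vertexCap (G.tail d) = ∞
      · simp [extTail, hd]
      · intro h
        simp only [extTail, hd, dite_false, ExtVertex.slot.injEq] at h
        subst h; exact Or.inl rfl
    · intro h
      simp only [extTail, ExtVertex.slot.injEq] at h
      subst h; rw [Slot.prev_next]; exact Or.inr (Or.inr rfl)
    · intro h
      simp only [extTail, ExtVertex.slot.injEq] at h
      subst h; exact Or.inr (Or.inl rfl)
  · rintro (rfl | rfl | rfl)
    · simp [extTail, hx]
    · simp [extTail]
    · simp [extTail, Slot.next_prev]

section Finite

variable [Finite D]

theorem ext_outflow_old [Fintype D] (k : G.ExtDart → ℝ) {v : V} (hv : G.vertexCap v = ∞) :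
    G.ext.outflow k (.old v hv) = G.outflow (fun d => k (.old d)) v := by
  classical
  rw [EmbeddedGraph.outflow, EmbeddedGraph.outflow]
  refine (Finset.sum_bij (fun d _ => ExtDart.old d) ?_ ?_ ?_ fun _ _ => rfl).symm
  · intro d hd
    rw [Finset.mem_filter] at hd ⊢
    exact ⟨Finset.mem_univ _, extTail_eq_old_iff.2 ⟨d, rfl, hd.2⟩⟩
  · intro a _ b _ h
    exact ExtDart.old.inj h
  · intro d hd
    obtain ⟨a, rfl, ha⟩ := extTail_eq_old_iff.1 (Finset.mem_filter.1 hd).2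
    exact ⟨a, by simp [ha], rfl⟩

theorem ext_outflow_slot (k : G.ExtDart → ℝ) (x : G.Slot) :
    G.ext.outflow k (.slot x) =
      k (.old x.1) + k (.ring x true) + k (.ring (Slot.prev x) false) := by
  classical
  have h : (Finset.univ.filter fun d => G.ext.tail d = .slot x) =
      {.old x.1, .ring x true, .ring (Slot.prev x) false} := by
    ext d
    simp only [Finset.mem_filter, Finset.mem_univ, true_and, Finset.mem_insert,
      Finset.mem_singleton]
    exact extTail_eq_slot_iff
  rw [EmbeddedGraph.outflow]
  trans ∑ d ∈ {ExtDart.old x.1, .ring x true, .ring (Slot.prev x) false}, k d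
  · rw [← h]
  · rw [Finset.sum_insert (by simp), Finset.sum_insert (by simp), Finset.sum_singleton, add_assoc]

theorem IsExtFlow.eq_zero_of_notMem_arcs (hf : G.IsExtFlow f) {d : D} (hd : d ∉ G.arcs) :
    f (.old d) = 0 := by
  have h := hf.le_cap (.old d)
  simp only [extCap, hd, if_false, nonpos_iff_eq_zero, ENNReal.ofReal_eq_zero] at h
  exact h.antisymm (hf.nonneg _)

theorem IsExtFlow.mem_arcs (hf : G.IsExtFlow f) {d : D} (hd : 0 < f (.old d)) : d ∈ G.arcs := by
  by_contra h
  exact hd.ne' (hf.eq_zero_of_notMem_arcs h)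

theorem IsExtFlow.ring_le (hf : G.IsExtFlow f) (x : G.Slot) (b : Bool) :
    f (.ring x b) ≤ (G.vertexCap (G.tail x.1)).toReal / 2 := by
  have h := hf.le_cap (.ring x b)
  have hx : G.vertexCap (G.tail x.1) / 2 ≠ ∞ := ENNReal.div_ne_top x.2 two_ne_zero
  have h1 := (ENNReal.ofReal_le_iff_le_toReal hx).1 h
  rwa [ENNReal.toReal_div, ENNReal.toReal_ofNat] at h1

theorem IsExtFlow.le_restrictedCap (hf : G.IsExtFlow f) (d : G.ExtDart) :
    f d ≤ G.restrictedCap f d := by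
  rcases d with d | ⟨x, b⟩
  · exact le_rfl
  · exact hf.ring_le x b

theorem IsExtFlow.outflow_extT (hf : G.IsExtFlow f) : G.ext.outflow f G.extT = 0 := by
  classical
  rw [EmbeddedGraph.outflow]
  refine Finset.sum_eq_zero fun d hd => ?_
  obtain ⟨a, rfl, ha⟩ := extTail_eq_old_iff.1 (Finset.mem_filter.1 hd).2
  exact hf.eq_zero_of_notMem_arcs fun h => G.t_no_out a h ha

/-- Functions below the restricted capacities with the same net flow at every vertex are flows of
the same value. -/
theorem IsExtFlow.of_le_restrictedCap (hf : G.IsExtFlow f) {f' : G.ExtDart → ℝ}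
    (h0 : ∀ d, 0 ≤ f' d) (hle : ∀ d, f' d ≤ G.restrictedCap f d)
    (hnet : ∀ v, G.ext.inflow f' v - G.ext.outflow f' v = G.ext.inflow f v - G.ext.outflow f v) :
    G.IsExtFlow f' ∧ G.extValue f' = G.extValue f := by
  have hf' : G.IsExtFlow f' := by
    refine ⟨h0, fun d => ?_, fun v hs ht => ?_⟩
    · rcases d with d | ⟨x, b⟩
      · exact (ENNReal.ofReal_le_ofReal (hle (.old d))).trans (hf.le_cap (.old d))
      · have hx : G.vertexCap (G.tail x.1) / 2 ≠ ∞ := ENNReal.div_ne_top x.2 two_ne_zero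
        refine (ENNReal.ofReal_le_iff_le_toReal hx).2 ?_
        rw [ENNReal.toReal_div, ENNReal.toReal_ofNat]
        exact hle (.ring x b)
    · have h1 := hf.conserve v hs ht
      linarith [hnet v]
  refine ⟨hf', ?_⟩
  have h1 := hnet G.extT
  rw [hf.outflow_extT, hf'.outflow_extT, sub_zero, sub_zero] at h1
  exact h1

theorem IsExtFlow.firstPass (hf : G.IsExtFlow f) :
    G.IsExtFlow (G.firstPass f) ∧ G.extValue (G.firstPass f) = G.extValue f :=
  hf.of_le_restrictedCap (fun _ => EmbeddedGraph.cancelClockwise_nonneg _)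
    (EmbeddedGraph.cancelClockwise_le G.ext_dualReachable hf.nonneg hf.le_restrictedCap)
    EmbeddedGraph.inflow_sub_outflow_cancelClockwise

theorem IsExtFlow.secondPass (hf : G.IsExtFlow f) :
    G.IsExtFlow (G.secondPass f) ∧ G.extValue (G.secondPass f) = G.extValue f :=
  hf.of_le_restrictedCap (fun _ => EmbeddedGraph.cancelClockwise_nonneg _)
    (EmbeddedGraph.cancelClockwise_le G.ext_mirror_dualReachable hf.nonneg hf.le_restrictedCap)
    (EmbeddedGraph.inflow_sub_outflow_cancelClockwise (M := G.ext.mirror))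

theorem IsExtFlow.firstPass_old_le (hf : G.IsExtFlow f) (d : D) :
    G.firstPass f (.old d) ≤ f (.old d) :=
  EmbeddedGraph.cancelClockwise_le G.ext_dualReachable hf.nonneg hf.le_restrictedCap (.old d)

theorem IsExtFlow.secondPass_old_le (hf : G.IsExtFlow f) (d : D) :
    G.secondPass f (.old d) ≤ f (.old d) :=
  EmbeddedGraph.cancelClockwise_le G.ext_mirror_dualReachable hf.nonneg hf.le_restrictedCap
    (.old d)

/-! ### From the extended graph back to the original graph -/

/-- A flow in the extended graph, seen in the original graph. -/
theorem IsExtFlow.isRingFlow [Fintype D] (hf : G.IsExtFlow f)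
    (hrev : ∀ d, 0 < f (.old d) → f (.old (G.rev d)) = 0) :
    G.IsRingFlow G.outer G.s G.t {v | G.vertexCap v ≠ ∞} (fun v => (G.vertexCap v).toReal)
      (fun d => f (.old d)) (G.ringFlow f) := by
  have hnet : ∀ v, v ≠ G.extS → v ≠ G.extT →
      G.ext.outflow (fun d => f (G.extRev d) - f d) v = 0 := by
    intro v hs ht
    rw [EmbeddedGraph.outflow_sub, sub_eq_zero]
    exact (G.ext.inflow_eq_outflow_rev f v).symm.trans (hf.conserve v hs ht)
  have hring : ∀ x, G.vertexCap (G.tail x) ≠ ∞ →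
      G.ringFlow f x = G.ringFlow f (G.rot.symm x) + f (.old (G.rev x)) - f (.old x) := by
    intro x hx
    have h1 := hnet (.slot ⟨x, hx⟩) nofun nofun
    rw [ext_outflow_slot] at h1
    have h2 := ringFlow_slot (f := f) ⟨x, hx⟩
    have h3 := ringFlow_slot (f := f) (Slot.prev (G := G) ⟨x, hx⟩)
    simp only [extRev, Bool.not_true, Bool.not_false] at h1
    simp only [Slot.prev] at h1 h2 h3
    linarith
  refine ⟨fun d => hf.nonneg _, hrev, fun d hd => G.s_no_in d (hf.mem_arcs hd), G.t_outer,
    fun v hs ht => ?_, hring, fun x y hxy hx => ?_⟩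
  · rw [EmbeddedGraph.inflow_eq_outflow_rev, ← sub_eq_zero, ← EmbeddedGraph.outflow_sub]
    by_cases hv : G.vertexCap v = ∞
    · have h1 := hnet (.old v hv) (fun h => hs (ExtVertex.old.inj h))
        (fun h => ht (ExtVertex.old.inj h))
      rwa [ext_outflow_old] at h1
    · have h1 : G.outflow (fun d => f (.old (G.rev d)) - f (.old d)) v =
          G.outflow (fun d => G.ringFlow f d - G.ringFlow f (G.rot.symm d)) v := by
        classical
        refine Finset.sum_congr rfl fun d hd => ?_
        have hd' : G.tail d = v := (Finset.mem_filter.1 hd).2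
        linarith [hring d (hd' ▸ hv)]
      have h2 := G.outflow_comp_rot (fun d => G.ringFlow f (G.rot.symm d)) v
      simp only [Equiv.symm_apply_apply] at h2
      rw [h1, EmbeddedGraph.outflow_sub, h2, sub_self]
  · have hy : G.vertexCap (G.tail y) ≠ ∞ := hxy ▸ hx
    have h1 := ringFlow_slot (f := f) ⟨x, hx⟩
    have h2 := ringFlow_slot (f := f) ⟨y, hy⟩
    have h3 := hf.ring_le ⟨x, hx⟩ true
    have h4 := hf.ring_le ⟨y, hy⟩ false
    have h5 := hf.nonneg (.ring ⟨x, hx⟩ false)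
    have h6 := hf.nonneg (.ring ⟨y, hy⟩ true)
    simp only [← hxy] at h4
    simp only at h1 h2 h3
    linarith

/-- Paths of saturated darts in the dual of the extended graph are paths of free steps and ring steps
in the dual of the original graph. A path that ends inside a ring has just crossed an edge of the ring
that is saturated clockwise, and is the first half of a ring step. -/
theorem reflTransGen_steps {f' : G.ExtDart → ℝ} (h0 : ∀ d, 0 ≤ f (.old d))
    (h0' : ∀ d, 0 ≤ f' (.old d)) (hrev : ∀ d, 0 < f' (.old d) → f' (.old (G.rev d)) = 0)
    {a : G.ExtFace}
    (h : Relation.ReflTransGen (fun b b' => ∃ d, G.ext.left d = b ∧ G.ext.right d = b' ∧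
      f' d - f' (G.ext.rev d) = G.restrictedCap f d) G.extOuter a) :
    (∀ b, a = .old b → Relation.ReflTransGen (G.Step {v | G.vertexCap v ≠ ∞}
      (fun v => (G.vertexCap v).toReal) (fun d => f' (.old d)) (G.ringFlow f')) G.outer b) ∧
    ∀ v hv, a = .inside v hv → ∃ x, G.tail x = v ∧
      G.ringFlow f' x = (G.vertexCap v).toReal / 2 ∧
      Relation.ReflTransGen (G.Step {v | G.vertexCap v ≠ ∞}
      (fun v => (G.vertexCap v).toReal) (fun d => f' (.old d)) (G.ringFlow f'))
        G.outer (G.right x) := by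
  induction h with
  | refl =>
    refine ⟨fun b hb => ?_, nofun⟩
    cases hb
    exact Relation.ReflTransGen.refl
  | tail _ hd ih =>
    obtain ⟨d, rfl, rfl, hd⟩ := hd
    rcases d with d | ⟨x, _ | _⟩
    · refine ⟨fun b hb => ?_, nofun⟩
      cases hb
      refine (ih.1 (G.left d) rfl).tail (Or.inl ⟨d, rfl, rfl, ?_⟩)
      by_contra hne
      have hpos := lt_of_le_of_ne (h0' (G.rev d)) (Ne.symm hne)
      have h1 := hrev _ hpos
      rw [G.rev_rev] at h1
      have h2 : f' (.old d) - f' (.old (G.rev d)) = f (.old d) := hd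
      linarith [h0 d]
    · refine ⟨fun b hb => ?_, nofun⟩
      cases hb
      obtain ⟨y, hy, hyu, hpath⟩ := ih.2 (G.tail x.1) _ rfl
      refine hpath.tail (Or.inr ⟨y, x.1, hy, hy ▸ x.2, rfl, rfl, ?_⟩)
      have h1 : f' (.ring x false) - f' (.ring x true) = (G.vertexCap (G.tail x.1)).toReal / 2 := hd
      rw [hyu, ringFlow_slot, hy]
      linarith
    · refine ⟨nofun, fun v hv h => ?_⟩
      cases h
      exact ⟨x.1, rfl, (ringFlow_slot x).trans hd, ih.1 _ rfl⟩

/-- The version of `reflTransGen_steps` for the mirror image. -/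
theorem reflTransGen_steps_mirror {f' : G.ExtDart → ℝ} (h0 : ∀ d, 0 ≤ f (.old d))
    (h0' : ∀ d, 0 ≤ f' (.old d)) (hrev : ∀ d, 0 < f' (.old d) → f' (.old (G.rev d)) = 0)
    {a : G.ExtFace}
    (h : Relation.ReflTransGen (fun b b' => ∃ d, G.ext.mirror.left d = b ∧
      G.ext.mirror.right d = b' ∧
      f' d - f' (G.ext.mirror.rev d) = G.restrictedCap f d) G.extOuter a) :
    (∀ b, a = .old b → Relation.ReflTransGen (G.mirror.Step {v | G.vertexCap v ≠ ∞}
      (fun v => (G.vertexCap v).toReal) (fun d => f' (.old d))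
      fun x => -G.ringFlow f' (G.rot.symm x)) G.outer b) ∧
    ∀ v hv, a = .inside v hv → ∃ x, G.tail x = v ∧
      -G.ringFlow f' x = (G.vertexCap v).toReal / 2 ∧
      Relation.ReflTransGen (G.mirror.Step {v | G.vertexCap v ≠ ∞}
      (fun v => (G.vertexCap v).toReal) (fun d => f' (.old d))
      fun x => -G.ringFlow f' (G.rot.symm x)) G.outer (G.right x) := by
  induction h with
  | refl =>
    refine ⟨fun b hb => ?_, nofun⟩
    cases hb
    exact Relation.ReflTransGen.refl
  | tail _ hd ih =>
    obtain ⟨d, rfl, rfl, hd⟩ := hd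
    simp only [EmbeddedGraph.mirror_right] at ih ⊢
    rcases d with d | ⟨x, _ | _⟩
    · refine ⟨fun b hb => ?_, nofun⟩
      cases hb
      refine (ih.1 (G.right d) rfl).tail (Or.inl ⟨d, rfl, G.mirror_right d, ?_⟩)
      by_contra hne
      have hpos := lt_of_le_of_ne (h0' (G.rev d)) (Ne.symm hne)
      have h1 := hrev _ hpos
      rw [G.rev_rev] at h1
      have h2 : f' (.old d) - f' (.old (G.rev d)) = f (.old d) := hd
      linarith [h0 d]
    · refine ⟨nofun, fun v hv h => ?_⟩
      cases h
      refine ⟨x.1, rfl, ?_, ih.1 _ rfl⟩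
      have h1 : f' (.ring x false) - f' (.ring x true) = (G.vertexCap (G.tail x.1)).toReal / 2 := hd
      rw [ringFlow_slot]
      linarith
    · refine ⟨fun b hb => ?_, nofun⟩
      cases hb
      obtain ⟨y, hy, hyu, hpath⟩ := ih.2 (G.tail x.1) _ rfl
      refine hpath.tail (Or.inr ⟨G.rot y, G.rot x.1, ?_, ?_, ?_, ?_, ?_⟩)
      · exact (G.tail_rot y).trans (hy.trans (G.tail_rot x.1).symm)
      · change G.vertexCap (G.tail (G.rot y)) ≠ ∞
        rw [G.tail_rot, hy]; exact x.2
      · rw [G.mirror_right, G.left_rot]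
      · rw [G.mirror_right, G.left_rot]
      · have h1 : f' (.ring x true) - f' (.ring x false) =
          (G.vertexCap (G.tail x.1)).toReal / 2 := hd
        change -G.ringFlow f' (G.rot.symm (G.rot y)) - -G.ringFlow f' (G.rot.symm (G.rot x.1)) =
          (G.vertexCap (G.tail (G.rot y))).toReal
        rw [Equiv.symm_apply_apply, Equiv.symm_apply_apply, hyu, ringFlow_slot, G.tail_rot, hy]
        linarith

end Finite

/-- After the first pass no circulation with arcs in the support of the flow has a face potential
that is somewhere larger than on the infinite face. -/
theorem IsExtFlow.potential_le_outer [Finite V] [Finite D] [Finite F] (hf : G.IsExtFlow f)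
    {ψ : F → ℝ} (hψ : ∀ d, ψ (G.right d) < ψ (G.left d) → 0 < G.firstPass f (.old d)) (a : F) :
    ψ a ≤ ψ G.outer := by
  cases nonempty_fintype D
  have hrev : ∀ d, 0 < G.firstPass f (.old d) → G.firstPass f (.old (G.rev d)) = 0 :=
    fun d hd => EmbeddedGraph.cancelClockwise_rev_eq_zero (M := G.ext) (d := .old d) hd
  exact (hf.firstPass.1.isRingFlow hrev).potential_le_outer G.isPlane
    (fun a => (reflTransGen_steps (fun d => hf.nonneg _) (fun d => hf.firstPass.1.nonneg _) hrev
      (EmbeddedGraph.reflTransGen_saturated G.ext_dualReachable hf.nonneg hf.le_restrictedCap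
        (.old a))).1 a rfl) hψ a

/-- After the second pass no circulation with arcs in the support of the flow has a face potential
that is somewhere smaller than on the infinite face. -/
theorem IsExtFlow.outer_le_potential [Finite V] [Finite D] [Finite F] (hf : G.IsExtFlow f)
    {ψ : F → ℝ} (hψ : ∀ d, ψ (G.right d) < ψ (G.left d) → 0 < G.secondPass f (.old d)) (a : F) :
    ψ G.outer ≤ ψ a := by
  cases nonempty_fintype D
  have hrev : ∀ d, 0 < G.secondPass f (.old d) → G.secondPass f (.old (G.rev d)) = 0 :=
    fun d hd => EmbeddedGraph.cancelClockwise_rev_eq_zero (M := G.ext.mirror) (d := .old d) hd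
  have h := (hf.secondPass.1.isRingFlow hrev).mirror.potential_le_outer G.isPlane.mirror
    (fun a => (reflTransGen_steps_mirror (fun d => hf.nonneg _)
      (fun d => hf.secondPass.1.nonneg _) hrev
      (EmbeddedGraph.reflTransGen_saturated G.ext_mirror_dualReachable hf.nonneg
        hf.le_restrictedCap (.old a))).1 a rfl) (ψ := fun a => -ψ a)
    (fun d hd => hψ d (by
      rw [G.mirror_right] at hd
      exact neg_lt_neg_iff.1 hd)) a
  exact neg_le_neg_iff.1 h

end PlanarNetwork

theorem mainTheorem5 {V D F : Type*} [Finite V] [Finite D] [Finite F] (G : PlanarNetwork V D F)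
    (f f' f'' : G.ExtDart → ℝ) (hf : G.IsExtFlow f)
    (hf' : f' = G.firstPass f) (hf'' : f'' = G.secondPass f') :
    G.IsExtFlow f'' ∧ G.extValue f'' = G.extValue f ∧
      (∀ e, G.restrict f'' e ≤ G.restrict f' e ∧ G.restrict f' e ≤ G.restrict f e) ∧
      G.Acyclic (G.restrict f'') := by
  have h1 : G.IsExtFlow f' ∧ G.extValue f' = G.extValue f := hf' ▸ hf.firstPass
  have h2 : G.IsExtFlow f'' ∧ G.extValue f'' = G.extValue f' := hf'' ▸ h1.1.secondPass
  have hle : ∀ d, f'' (.old d) ≤ f' (.old d) := fun d => hf'' ▸ h1.1.secondPass_old_le d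
  refine ⟨h2.1, h2.2.trans h1.2, fun e => ⟨hle e.1, hf' ▸ hf.firstPass_old_le e.1⟩, ?_⟩
  rintro ⟨k, e, he, hpos⟩
  cases nonempty_fintype D
  have hpos' : ∀ i, 0 < f'' (.old (e i).1) := hpos
  have hrev : ∀ d, 0 < f'' (.old d) → f'' (.old (G.rev d)) = 0 := fun d hd => by
    rw [hf''] at hd ⊢
    exact EmbeddedGraph.cancelClockwise_rev_eq_zero (M := G.ext.mirror) (d := .old d) hd
  obtain ⟨ψ, hψ, d, hd⟩ := G.isPlane.exists_potential_of_cycle (fun i => (e i).1) he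
    fun i j hij => by
      have := hpos' i
      rw [show (e i).1 = G.rev (e j).1 from hij, hrev _ (hpos' j)] at this
      exact lt_irrefl _ this
  have hψ'' : ∀ d, ψ (G.right d) < ψ (G.left d) → 0 < f'' (.old d) := fun d hd => by
    obtain ⟨i, rfl⟩ := hψ d hd
    exact hpos' i
  -- the flow on the cycle is positive after both passes, so that `ψ` is constant
  have h3 := hf.potential_le_outer (ψ := ψ)
    fun d hd => hf' ▸ (hψ'' d hd).trans_le (hle d)
  have h4 := h1.1.outer_le_potential (ψ := ψ) fun d hd => hf'' ▸ hψ'' d hd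
  exact hd.not_ge ((h3 _).trans (h4 _))
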